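/- Let $M$ be a complex manifold of (pure) dimension $m\ge 1$ (for example a compact Kähler manifold), with holomorphic tangent bundle $T_M$, cotangent bundle $\Omega^1_M$ and canonical bundle $K_M=\det\Omega^1_M$. Let $L$ be a holomorphic line bundle on $M$ and let $g\in H^0(M,S^2\Omega^1_M\otimes L)$ be a holomorphic conformal structure, i.e. a holomorphic section that is non-degenerate at every point; regard it also as an isomorphism $g:T_M\to\Omega^1_M\otimes L$. For a holomorphic vector bundle $E$ on $M$ with local trivializations over an open cover $\{U_\alpha\}$ and transition functions $t_{\alpha\beta}:E_\beta\to E_\alpha$, let $b(E)\in H^1(M,\Omega^1_M\otimes\mathrm{End}(E))$ be the Atiyah class, i.e. the class of the Čech $1$-cocycle $dt_{\alpha\beta}$, a matrix of holomorphic $1$-forms read as a map from the trivialization $E_\beta$ to the trivialization $E_\alpha$. Put $a(E)=-\frac{1}{2\pi i}\,b(E)$ (the normalized Atiyah class) and $c_1(E)=\mathrm{tr}\,a(E)\in H^1(M,\Omega^1_M)$. In particular $c_1(K_M)\in H^1(M,\Omega^1_M)$ is the class so obtained from the line bundle $K_M$. Then, in $H^1(M,\Omega^1_M\otimes T_M\otimes\Omega^1_M)=H^1(M,\Omega^1_M\otimes\mathrm{End}(\Omega^1_M))$,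 $$a(\Omega^1_M)=\frac{c_1(K_M)}{m}\otimes \mathrm{id}+\mathrm{id}\otimes\frac{c_1(K_M)}{m}-g\otimes g^{-1}\Big(\frac{c_1(K_M)}{m}\Big).$$ Here the three terms on the right are the images of $c_1(K_M)/m$ under the maps on $H^1$ induced by the homomorphisms of holomorphic vector bundles $\Omega^1_M\to\Omega^1_M\otimes\mathrm{End}(\Omega^1_M)=\mathrm{Hom}(T_M,\mathrm{End}(\Omega^1_M))$ which send a covector $\alpha$ to, respectively, $$v\mapsto\big(\eta\mapsto\alpha(v)\,\eta\big),\qquad v\mapsto\big(\eta\mapsto\eta(v)\,\alpha\big),\qquad v\mapsto\Big(\eta\mapsto\big(w\mapsto\eta\big(g^{-1}(\alpha\otimes g(v,w))\big)\big)\Big)$$ for $v,w\in T_M$ and $\eta\in\Omega^1_M$. -/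

import Mathlib

open Bundle Set Topology
open scoped Manifold ContDiff

set_option maxSynthPendingDepth 3
set_option synthInstance.maxHeartbeats 200000
set_option maxHeartbeats 1000000
set_option linter.unusedSectionVars false

noncomputable section

section Cohomology

variable (E : Type*) [NormedAddCommGroup E] [NormedSpace ℂ E]
  {M : Type*} [TopologicalSpace M] [ChartedSpace E M]
  (F : Type*) [NormedAddCommGroup F] [NormedSpace ℂ F]
  (V : M → Type*) [TopologicalSpace (TotalSpace F V)]
  [∀ x, AddCommGroup (V x)] [∀ x, Module ℂ (V x)] [∀ x, TopologicalSpace (V x)]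
  [FiberBundle F V] [VectorBundle ℂ F V]

/-- The section `s` of the bundle `V` is holomorphic on `U`. -/
def IsHol (s : Π x, V x) (U : Set M) : Prop :=
  ContMDiffOn 𝓘(ℂ, E) (𝓘(ℂ, E).prod 𝓘(ℂ, F)) ω (fun x ↦ TotalSpace.mk' F x (s x)) U

/-- An open cover of `M` indexed by the points of `M`, where the `x`-th set contains `x`. Every open
cover has a refinement of this form. -/
def IsPointedCover (U : M → Set M) : Prop := ∀ x, IsOpen (U x) ∧ x ∈ U x

/-- `c` restricts to a Čech 1-cocycle of the cover `U` with values in the sheaf of holomorphic sections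
of `V`. Only the values of `c x y` on `U x ∩ U y` matter. -/
def IsCocycleOn (U : M → Set M) (c : M → M → Π p, V p) : Prop :=
  (∀ x y, IsHol E F V (c x y) (U x ∩ U y)) ∧
    ∀ x y z, ∀ p ∈ U x ∩ U y ∩ U z, c x z p = c x y p + c y z p

/-- `c` restricts to the coboundary of a Čech 0-cochain of the cover `U` with values in the sheaf of
holomorphic sections of `V`. -/
def IsCoboundaryOn (U : M → Set M) (c : M → M → Π p, V p) : Prop :=
  ∃ b : M → Π p, V p, (∀ x, IsHol E F V (b x) (U x)) ∧
    ∀ x y, ∀ p ∈ U x ∩ U y, c x y p = b y p - b x p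

variable {E F V}

theorem IsHol.mono {s : Π x, V x} {U U' : Set M} (h : IsHol E F V s U) (hU : U' ⊆ U) :
    IsHol E F V s U' := ContMDiffOn.mono h hU

theorem IsHol.congr {s t : Π x, V x} {U : Set M} (h : IsHol E F V s U) (hU : ∀ x ∈ U, t x = s x) :
    IsHol E F V t U := ContMDiffOn.congr h (fun x hx ↦ by simp only [hU x hx])

theorem IsHol.zero (U : Set M) : IsHol E F V (0 : Π x, V x) U :=
  contMDiffOn_zeroSection (𝕜 := ℂ) (E := V)

theorem IsHol.add {s t : Π x, V x} {U : Set M} (hs : IsHol E F V s U) (ht : IsHol E F V t U) :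
    IsHol E F V (s + t) U := ContMDiffOn.add_section hs ht

theorem IsHol.smul {s : Π x, V x} {U : Set M} (a : ℂ) (hs : IsHol E F V s U) :
    IsHol E F V (a • s) U := ContMDiffOn.const_smul_section hs

theorem IsPointedCover.inter {U U' : M → Set M} (h : IsPointedCover U) (h' : IsPointedCover U') :
    IsPointedCover (fun x ↦ U x ∩ U' x) :=
  fun x ↦ ⟨(h x).1.inter (h' x).1, (h x).2, (h' x).2⟩

variable (E F V)

/-- The families that are a Čech 1-cocycle for some pointed cover. Sections are represented by total
functions, so passing to a finer pointed cover does not change the family. -/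
def cechCocycles : Submodule ℂ (M → M → Π p, V p) where
  carrier := {c | ∃ U : M → Set M, IsPointedCover U ∧ IsCocycleOn E F V U c}
  zero_mem' := ⟨fun _ ↦ univ, fun _ ↦ ⟨isOpen_univ, mem_univ _⟩, fun _ _ ↦ IsHol.zero _, by simp⟩
  add_mem' := by
    rintro c d ⟨U, hU, hc, hc'⟩ ⟨W, hW, hd, hd'⟩
    refine ⟨_, hU.inter hW, fun x y ↦ ?_, fun x y z p hp ↦ ?_⟩
    · exact ((hc x y).mono (by grind)).add ((hd x y).mono (by grind))
    · have h1 := hc' x y z p (by grind)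
      have h2 := hd' x y z p (by grind)
      simp only [Pi.add_apply, h1, h2]
      abel
  smul_mem' := by
    rintro a c ⟨U, hU, hc, hc'⟩
    refine ⟨U, hU, fun x y ↦ (hc x y).smul a, fun x y z p hp ↦ ?_⟩
    simp [hc' x y z p hp]

/-- The families that are a coboundary for some pointed cover. -/
def cechCoboundaries : Submodule ℂ (M → M → Π p, V p) where
  carrier := {c | ∃ U : M → Set M, IsPointedCover U ∧ IsCoboundaryOn E F V U c}
  zero_mem' := ⟨fun _ ↦ univ, fun _ ↦ ⟨isOpen_univ, mem_univ _⟩, 0, fun _ ↦ IsHol.zero _, by simp⟩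
  add_mem' := by
    rintro c d ⟨U, hU, a, hc, hc'⟩ ⟨W, hW, b, hd, hd'⟩
    refine ⟨_, hU.inter hW, a + b, fun x ↦ ?_, fun x y p hp ↦ ?_⟩
    · exact ((hc x).mono (by grind)).add ((hd x).mono (by grind))
    · have h1 := hc' x y p (by grind)
      have h2 := hd' x y p (by grind)
      simp only [Pi.add_apply, h1, h2]
      abel
  smul_mem' := by
    rintro a c ⟨U, hU, b, hc, hc'⟩
    refine ⟨U, hU, a • b, fun x ↦ (hc x).smul a, fun x y p hp ↦ ?_⟩
    simp [hc' x y p hp, smul_sub]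

/-- Čech cohomology `H¹(M, V)` of the sheaf of holomorphic sections of the holomorphic vector bundle
`V`: the colimit over all (pointed) open covers of cocycles modulo coboundaries. Two cocycles are
identified if and only if their difference becomes a coboundary on a common refinement. -/
def CechH1 : Type _ :=
  cechCocycles E F V ⧸ (cechCoboundaries E F V).submoduleOf (cechCocycles E F V)

instance : AddCommGroup (CechH1 E F V) :=
  inferInstanceAs (AddCommGroup (cechCocycles E F V ⧸ _))

instance : Module ℂ (CechH1 E F V) :=
  inferInstanceAs (Module ℂ (cechCocycles E F V ⧸ _))

/-- The class of a cocycle. -/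
def CechH1.mk : cechCocycles E F V →ₗ[ℂ] CechH1 E F V :=
  ((cechCoboundaries E F V).submoduleOf (cechCocycles E F V)).mkQ

end Cohomology

section Map

variable {E : Type*} [NormedAddCommGroup E] [NormedSpace ℂ E]
  {M : Type*} [TopologicalSpace M] [ChartedSpace E M]
  {F : Type*} [NormedAddCommGroup F] [NormedSpace ℂ F]
  {V : M → Type*} [TopologicalSpace (TotalSpace F V)]
  [∀ x, AddCommGroup (V x)] [∀ x, Module ℂ (V x)] [∀ x, TopologicalSpace (V x)]
  [FiberBundle F V] [VectorBundle ℂ F V]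
  {F' : Type*} [NormedAddCommGroup F'] [NormedSpace ℂ F']
  {V' : M → Type*} [TopologicalSpace (TotalSpace F' V')]
  [∀ x, AddCommGroup (V' x)] [∀ x, Module ℂ (V' x)] [∀ x, TopologicalSpace (V' x)]
  [FiberBundle F' V'] [VectorBundle ℂ F' V']

variable (E F V F' V')

/-- Homomorphisms of holomorphic vector bundles (over the identity of `M`): families of linear maps
of the fibres that send holomorphic local sections to holomorphic local sections. -/
structure HolBundleHom where
  toFun : Π x, V x →ₗ[ℂ] V' x
  isHol : ∀ (U : Set M) (s : Π x, V x), IsOpen U → IsHol E F V s U →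
    IsHol E F' V' (fun x ↦ toFun x (s x)) U

variable {E F V F' V'}

/-- The action of a bundle homomorphism on cochains. -/
def HolBundleHom.cochainMap (φ : HolBundleHom E F V F' V') :
    (M → M → Π p, V p) →ₗ[ℂ] (M → M → Π p, V' p) where
  toFun c x y p := φ.toFun p (c x y p)
  map_add' c d := by ext; simp
  map_smul' a c := by ext; simp

theorem HolBundleHom.mapsTo_cocycles (φ : HolBundleHom E F V F' V') :
    ∀ c ∈ cechCocycles E F V, φ.cochainMap c ∈ cechCocycles E F' V' := by
  rintro c ⟨U, hU, hc, hc'⟩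
  refine ⟨U, hU, fun x y ↦ φ.isHol _ _ ((hU x).1.inter (hU y).1) (hc x y), fun x y z p hp ↦ ?_⟩
  simp [HolBundleHom.cochainMap, hc' x y z p hp]

theorem HolBundleHom.mapsTo_coboundaries (φ : HolBundleHom E F V F' V') :
    ∀ c ∈ cechCoboundaries E F V, φ.cochainMap c ∈ cechCoboundaries E F' V' := by
  rintro c ⟨U, hU, b, hc, hc'⟩
  refine ⟨U, hU, fun x p ↦ φ.toFun p (b x p), fun x ↦ φ.isHol _ _ (hU x).1 (hc x),
    fun x y p hp ↦ ?_⟩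
  simp [HolBundleHom.cochainMap, hc' x y p hp]

/-- The map on `H¹` induced by a homomorphism of holomorphic vector bundles. -/
def CechH1.map (φ : HolBundleHom E F V F' V') : CechH1 E F V →ₗ[ℂ] CechH1 E F' V' :=
  Submodule.mapQ _ _ (φ.cochainMap.restrict φ.mapsTo_cocycles)
    (fun c hc ↦ φ.mapsTo_coboundaries c hc)

end Map

section Criteria

variable {E : Type*} [NormedAddCommGroup E] [NormedSpace ℂ E]
  {M : Type*} [TopologicalSpace M] [ChartedSpace E M]
  {F : Type*} [NormedAddCommGroup F] [NormedSpace ℂ F]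
  {V : M → Type*} [TopologicalSpace (TotalSpace F V)]
  [∀ x, AddCommGroup (V x)] [∀ x, Module ℂ (V x)] [∀ x, TopologicalSpace (V x)]
  [FiberBundle F V] [VectorBundle ℂ F V]
  {F' : Type*} [NormedAddCommGroup F'] [NormedSpace ℂ F']
  {V' : M → Type*} [TopologicalSpace (TotalSpace F' V')]
  [∀ x, AddCommGroup (V' x)] [∀ x, Module ℂ (V' x)] [∀ x, TopologicalSpace (V' x)]
  [FiberBundle F' V'] [VectorBundle ℂ F' V']

theorem contMDiffAt_of_clm_apply [FiniteDimensional ℂ F] {f : M → F →L[ℂ] F'} {x₀ : M}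
    (h : ∀ e, ContMDiffAt 𝓘(ℂ, E) 𝓘(ℂ, F') ω (fun x ↦ f x e) x₀) :
    ContMDiffAt 𝓘(ℂ, E) 𝓘(ℂ, F →L[ℂ] F') ω f x₀ := by
  let d := Module.finrank ℂ F
  have hd : d = Module.finrank ℂ (Fin d → ℂ) := (Module.finrank_fin_fun ℂ).symm
  let e₁ := ContinuousLinearEquiv.ofFinrankEq hd
  let e₂ := (e₁.arrowCongr (1 : F' ≃L[ℂ] F')).trans (ContinuousLinearEquiv.piRing (Fin d))
  have h1 : ContMDiffAt 𝓘(ℂ, E) 𝓘(ℂ, Fin d → F') ω (fun x ↦ e₂ (f x)) x₀ :=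
    contMDiffAt_pi_space.2 fun i ↦ h _
  have h2 := (e₂.symm.contDiff (n := ω)).contMDiff.contMDiffAt.comp x₀ h1
  convert! h2 using 1
  ext1 x
  simp

/-- A section of `Hom(V, V')` is holomorphic as soon as it maps holomorphic local sections to
holomorphic local sections. -/
theorem IsHol.hom_of_apply [∀ x, IsTopologicalAddGroup (V' x)] [∀ x, ContinuousSMul ℂ (V' x)]
    [FiniteDimensional ℂ F] [ContMDiffVectorBundle ω F V 𝓘(ℂ, E)]
    {s : Π x, V x →L[ℂ] V' x} {U : Set M} (hU : IsOpen U)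
    (h : ∀ (W : Set M) (v : Π x, V x), IsOpen W → W ⊆ U → IsHol E F V v W →
      IsHol E F' V' (fun x ↦ s x (v x)) W) :
    IsHol E (F →L[ℂ] F') (fun x ↦ V x →L[ℂ] V' x) s U := by
  intro x₀ hx₀
  apply ContMDiffAt.contMDiffWithinAt
  rw [contMDiffAt_hom_bundle]
  refine ⟨contMDiffAt_id, contMDiffAt_of_clm_apply fun e ↦ ?_⟩
  set t := trivializationAt F V x₀
  have hxt : x₀ ∈ t.baseSet := FiberBundle.mem_baseSet_trivializationAt' x₀
  have hWo : IsOpen (U ∩ t.baseSet) := hU.inter t.open_baseSet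
  have hv : IsHol E F V (fun x ↦ t.symmL ℂ x e) (U ∩ t.baseSet) := by
    apply IsHol.mono _ inter_subset_right
    refine (t.contMDiffOn_section_baseSet_iff).2 ?_
    refine (contMDiffOn_const (c := e)).congr fun x hx ↦ ?_
    have := t.continuousLinearMapAt_symmL (R := ℂ) hx e
    rwa [Trivialization.continuousLinearMapAt_apply, Trivialization.coe_linearMapAt_of_mem _ hx]
      at this
  have h1 := (h _ _ hWo inter_subset_left hv).contMDiffAt (hWo.mem_nhds ⟨hx₀, hxt⟩)
  rw [contMDiffAt_section] at h1
  refine h1.congr_of_eventuallyEq ?_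
  have hxt' : x₀ ∈ (trivializationAt F' V' x₀).baseSet := FiberBundle.mem_baseSet_trivializationAt' x₀
  filter_upwards [(trivializationAt F' V' x₀).open_baseSet.mem_nhds hxt'] with x hx
  simp only [ContinuousLinearMap.inCoordinates, ContinuousLinearMap.comp_apply]
  rw [Trivialization.continuousLinearMapAt_apply, Trivialization.coe_linearMapAt_of_mem _ hx]

theorem IsHol.hom_apply [∀ x, IsTopologicalAddGroup (V' x)] [∀ x, ContinuousSMul ℂ (V' x)]
    {s : Π x, V x →L[ℂ] V' x} {U : Set M}
    (h : IsHol E (F →L[ℂ] F') (fun x ↦ V x →L[ℂ] V' x) s U) {v : Π x, V x} (hv : IsHol E F V v U) :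
    IsHol E F' V' (fun x ↦ s x (v x)) U :=
  ContMDiffOn.clm_bundle_apply h hv

theorem IsHol.iff_contMDiffOn {f : M → F} {U : Set M} :
    IsHol E F (fun _ ↦ F) f U ↔ ContMDiffOn 𝓘(ℂ, E) 𝓘(ℂ, F) ω f U := by
  constructor
  · intro h x hx
    exact contMDiffWithinAt_section.1 (h x hx)
  · intro h x hx
    exact contMDiffWithinAt_section.2 (h x hx)

theorem IsHol.smul_fun {f : M → ℂ} {v : Π x, V x} {U : Set M}
    (hf : ContMDiffOn 𝓘(ℂ, E) 𝓘(ℂ, ℂ) ω f U) (hv : IsHol E F V v U) :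
    IsHol E F V (fun x ↦ f x • v x) U := ContMDiffOn.smul_section hf hv

theorem IsHol.mfderiv [IsManifold 𝓘(ℂ, E) ω M] {f : M → F} {U : Set M} (hU : IsOpen U)
    (hf : ContMDiffOn 𝓘(ℂ, E) 𝓘(ℂ, F) ω f U) :
    IsHol E (E →L[ℂ] F) (fun p ↦ TangentSpace 𝓘(ℂ, E) p →L[ℂ] F)
      (fun p ↦ mfderiv 𝓘(ℂ, E) 𝓘(ℂ, F) f p) U := by
  intro x₀ hx₀
  apply ContMDiffAt.contMDiffWithinAt
  rw [contMDiffAt_hom_bundle]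
  refine ⟨contMDiffAt_id, ?_⟩
  have h := ContMDiffAt.mfderiv_const (m := ω) (hf.contMDiffAt (hU.mem_nhds hx₀)) le_rfl
  refine h.congr_of_eventuallyEq (Filter.Eventually.of_forall fun x ↦ ?_)
  simp [inTangentCoordinates, ContinuousLinearMap.inCoordinates]
  rfl

theorem contMDiffOn_mfderiv_apply [IsManifold 𝓘(ℂ, E) ω M] {f : M → F} {U : Set M}
    (hU : IsOpen U) (hf : ContMDiffOn 𝓘(ℂ, E) 𝓘(ℂ, F) ω f U)
    {v : Π p : M, TangentSpace 𝓘(ℂ, E) p} (hv : IsHol E E (TangentSpace 𝓘(ℂ, E)) v U) :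
    ContMDiffOn 𝓘(ℂ, E) 𝓘(ℂ, F) ω
      (fun p ↦ (mfderiv 𝓘(ℂ, E) 𝓘(ℂ, F) f p (v p) : F)) U :=
  IsHol.iff_contMDiffOn.1 (IsHol.hom_apply (IsHol.mfderiv hU hf) hv)

end Criteria

/- Shortcuts for instance search. -/
section Instances

variable {A B : Type*} [AddCommGroup A] [Module ℂ A] [TopologicalSpace A]
  [AddCommGroup B] [Module ℂ B] [TopologicalSpace B] [IsTopologicalAddGroup B]
  [ContinuousSMul ℂ B]

instance clmContinuousSMul : ContinuousSMul ℂ (A →L[ℂ] B) := inferInstance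

instance clmContinuousConstSMul : ContinuousConstSMul ℂ (A →L[ℂ] B) := inferInstance

instance clmIsTopologicalAddGroup : IsTopologicalAddGroup (A →L[ℂ] B) := inferInstance

instance clmContinuousAdd : ContinuousAdd (A →L[ℂ] B) :=
  (inferInstance : IsTopologicalAddGroup (A →L[ℂ] B)).toContinuousAdd

end Instances

section Transition

variable {M : Type*} [TopologicalSpace M]
  (F : Type*) [NormedAddCommGroup F] [NormedSpace ℂ F]
  (V : M → Type*) [TopologicalSpace (TotalSpace F V)]
  [∀ x, AddCommGroup (V x)] [∀ x, Module ℂ (V x)] [∀ x, TopologicalSpace (V x)]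
  [FiberBundle F V] [VectorBundle ℂ F V]

/-- The transition function `t_{xy}` at `q`, from the `y`-th to the `x`-th of the distinguished
local trivializations of `V`. -/
def transition (x y q : M) : F →L[ℂ] F :=
  ((trivializationAt F V y).coordChangeL ℂ (trivializationAt F V x) q : F →L[ℂ] F)

theorem transition_apply {x y q : M} (hx : q ∈ (trivializationAt F V x).baseSet)
    (hy : q ∈ (trivializationAt F V y).baseSet) (w : F) :
    transition F V x y q w = (trivializationAt F V x).continuousLinearMapAt ℂ q
      ((trivializationAt F V y).symmL ℂ q w) := by
  simp only [transition, ContinuousLinearEquiv.coe_coe]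
  rw [Trivialization.coordChangeL_apply _ _ ⟨hy, hx⟩,
    Trivialization.continuousLinearMapAt_apply_of_mem ℂ _ hx, Trivialization.symmL_apply _ hy]

end Transition

section Atiyah

variable (E : Type*) [NormedAddCommGroup E] [NormedSpace ℂ E]
  {M : Type*} [TopologicalSpace M] [ChartedSpace E M]

/-- The holomorphic tangent bundle `T_M`. -/
abbrev HolTangent (p : M) : Type _ := TangentSpace 𝓘(ℂ, E) p

/-- The holomorphic cotangent bundle `Ω¹_M`. -/
abbrev HolCotangent (p : M) : Type _ := HolTangent E p →L[ℂ] ℂ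

instance [IsManifold 𝓘(ℂ, E) ω M] :
    ContMDiffVectorBundle ω E (TangentSpace 𝓘(ℂ, E) : M → Type _) 𝓘(ℂ, E) :=
  TangentBundle.contMDiffVectorBundle

instance (p : M) : T2Space (TangentSpace 𝓘(ℂ, E) p) := (inferInstance : T2Space E)

instance [FiniteDimensional ℂ E] (p : M) : FiniteDimensional ℂ (TangentSpace 𝓘(ℂ, E) p) :=
  inferInstanceAs (FiniteDimensional ℂ E)

variable  (F : Type*) [NormedAddCommGroup F] [NormedSpace ℂ F]
  (V : M → Type*) [TopologicalSpace (TotalSpace F V)]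
  [∀ x, AddCommGroup (V x)] [∀ x, Module ℂ (V x)] [∀ x, TopologicalSpace (V x)]
  [∀ x, IsTopologicalAddGroup (V x)] [∀ x, ContinuousSMul ℂ (V x)]
  [FiberBundle F V] [VectorBundle ℂ F V]

/-- The bundle `Ω¹ ⊗ End V = Hom(T, End V)`. For `V = Ω¹` this is `Ω¹ ⊗ T ⊗ Ω¹`: the tensor
`α ⊗ u ⊗ β` is the map `v ↦ (η ↦ α(v) η(u) β)`. -/
abbrev EndForm (p : M) : Type _ := HolTangent E p →L[ℂ] (V p →L[ℂ] V p)

/-- `H¹(M, Ω¹ ⊗ End V)`. -/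
abbrev EndFormH1 [IsManifold 𝓘(ℂ, E) ω M] : Type _ := CechH1 E (E →L[ℂ] (F →L[ℂ] F)) (EndForm E V)

/-- Homomorphisms of holomorphic vector bundles `Ω¹ → Ω¹ ⊗ End V`. -/
abbrev FormToEndForm [IsManifold 𝓘(ℂ, E) ω M] : Type _ :=
  HolBundleHom E (E →L[ℂ] ℂ) (HolCotangent E) (E →L[ℂ] (F →L[ℂ] F)) (EndForm E V)

/-- The differential `dt_{xy}` at `p` of the transition function. -/
def dTransition (x y p : M) : HolTangent E p →L[ℂ] (F →L[ℂ] F) :=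
  mfderiv 𝓘(ℂ, E) 𝓘(ℂ, F →L[ℂ] F) (transition F V x y) p

/-- The cochain `dt_{xy}`, read as a 1-form with values in `End V`: the matrix of 1-forms `dt_{xy}`
takes the `y`-th to the `x`-th trivialization. -/
def atiyahCochain (x y p : M) : EndForm E V p :=
  ((ContinuousLinearMap.postcomp (V p) ((trivializationAt F V x).symmL ℂ p)).comp
    (ContinuousLinearMap.precomp F ((trivializationAt F V y).continuousLinearMapAt ℂ p))).comp
  (dTransition E F V x y p)

variable {E F V}

theorem atiyahCochain_apply (x y p : M) (v : HolTangent E p) (e : V p) :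
    atiyahCochain E F V x y p v e = (trivializationAt F V x).symmL ℂ p
      (dTransition E F V x y p v ((trivializationAt F V y).continuousLinearMapAt ℂ p e)) := rfl

variable (E F V)

variable [FiniteDimensional ℂ E] [FiniteDimensional ℂ F] [IsManifold 𝓘(ℂ, E) ω M]
  [ContMDiffVectorBundle ω F V 𝓘(ℂ, E)]

theorem isHol_atiyahCochain (x y : M) :
    IsHol E (E →L[ℂ] (F →L[ℂ] F)) (EndForm E V) (atiyahCochain E F V x y)
      ((trivializationAt F V x).baseSet ∩ (trivializationAt F V y).baseSet) := by
  set tx := trivializationAt F V x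
  set ty := trivializationAt F V y
  have hU : IsOpen (tx.baseSet ∩ ty.baseSet) := tx.open_baseSet.inter ty.open_baseSet
  have htr : ContMDiffOn 𝓘(ℂ, E) 𝓘(ℂ, F →L[ℂ] F) ω (transition F V x y)
      (tx.baseSet ∩ ty.baseSet) := by
    rw [inter_comm]
    exact contMDiffOn_coordChangeL ty tx
  refine IsHol.hom_of_apply hU fun W v hW hWU hv ↦ ?_
  refine IsHol.hom_of_apply hW fun W' e hW' hWU' he ↦ ?_
  have hs : W' ⊆ tx.baseSet ∩ ty.baseSet := hWU'.trans hWU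
  have h1 := contMDiffOn_mfderiv_apply hW' (htr.mono hs) (hv.mono hWU')
  have h2 : ContMDiffOn 𝓘(ℂ, E) 𝓘(ℂ, F) ω (fun p ↦ ty.continuousLinearMapAt ℂ p (e p)) W' := by
    refine ((ty.contMDiffOn_section_iff hW' (hs.trans inter_subset_right)).1 he).congr ?_
    intro p hp
    rw [Trivialization.continuousLinearMapAt_apply,
      Trivialization.coe_linearMapAt_of_mem _ (hs hp).2]
  have h3 := h1.clm_apply h2
  refine (tx.contMDiffOn_section_iff hW' (hs.trans inter_subset_left)).2 (h3.congr ?_)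
  intro p hp
  have := tx.continuousLinearMapAt_symmL (R := ℂ) (hs hp).1
    (dTransition E F V x y p (v p) (ty.continuousLinearMapAt ℂ p (e p)))
  rwa [Trivialization.continuousLinearMapAt_apply,
    Trivialization.coe_linearMapAt_of_mem _ (hs hp).1] at this

theorem atiyahCochain_add (x y z p : M)
    (hx : p ∈ (trivializationAt F V x).baseSet) (hy : p ∈ (trivializationAt F V y).baseSet)
    (hz : p ∈ (trivializationAt F V z).baseSet) :
    atiyahCochain E F V x z p = atiyahCochain E F V x y p + atiyahCochain E F V y z p := by
  set tx := trivializationAt F V x with htx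
  set ty := trivializationAt F V y with hty
  set tz := trivializationAt F V z with htz
  have hd : ∀ a b : M, p ∈ (trivializationAt F V a).baseSet →
      p ∈ (trivializationAt F V b).baseSet →
      MDifferentiableAt 𝓘(ℂ, E) 𝓘(ℂ, F →L[ℂ] F) (transition F V a b) p := by
    intro a b ha hb
    exact (contMDiffAt_coordChangeL (n := ω) hb ha).mdifferentiableAt (by simp)
  have hxy := hd x y hx hy
  have hyz := hd y z hy hz
  have hcomp : transition F V x z =ᶠ[𝓝 p]
      fun q ↦ (transition F V x y q).comp (transition F V y z q) := by
    filter_upwards [tx.open_baseSet.mem_nhds hx, ty.open_baseSet.mem_nhds hy,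
      tz.open_baseSet.mem_nhds hz] with q h1 h2 h3
    ext v
    rw [ContinuousLinearMap.comp_apply, transition_apply F V h1 h3, transition_apply F V h1 h2,
      transition_apply F V h2 h3, Trivialization.symmL_continuousLinearMapAt _ h2]
  have hder : ∀ v : HolTangent E p, dTransition E F V x z p v =
      transition F V x y p * dTransition E F V y z p v +
        dTransition E F V x y p v * transition F V y z p := by
    intro v
    have h1 := hcomp.mfderiv_eq (I := 𝓘(ℂ, E)) (I' := 𝓘(ℂ, F →L[ℂ] F))
    have h2 := (hxy.hasMFDerivAt.mul' hyz.hasMFDerivAt).mfderiv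
    exact DFunLike.congr_fun (h1.trans h2) v
  have htr1 : ∀ w, tx.symmL ℂ p (transition F V x y p w) = ty.symmL ℂ p w := by
    intro w
    rw [transition_apply F V hx hy, Trivialization.symmL_continuousLinearMapAt _ hx]
  have htr2 : ∀ w : V p, transition F V y z p (tz.continuousLinearMapAt ℂ p w) =
      ty.continuousLinearMapAt ℂ p w := by
    intro w
    rw [transition_apply F V hy hz, Trivialization.symmL_continuousLinearMapAt _ hz]
  ext v e
  simp only [_root_.add_apply, atiyahCochain_apply, hder, map_add]
  simp only [mul_apply_eq_comp]
  rw [htr1, htr2, add_comm]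

theorem atiyahCochain_mem :
    atiyahCochain E F V ∈ cechCocycles E (E →L[ℂ] (F →L[ℂ] F)) (EndForm E V) :=
  ⟨fun x ↦ (trivializationAt F V x).baseSet,
    fun x ↦ ⟨(trivializationAt F V x).open_baseSet, FiberBundle.mem_baseSet_trivializationAt' x⟩,
    fun x y ↦ isHol_atiyahCochain E F V x y,
    fun x y z p hp ↦ atiyahCochain_add E F V x y z p hp.1.1 hp.1.2 hp.2⟩

/-- The Atiyah class `b(V)` in `H¹(M, Ω¹ ⊗ End V)`. -/
def atiyahClass : EndFormH1 E F V :=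
  CechH1.mk _ _ _ ⟨atiyahCochain E F V, atiyahCochain_mem E F V⟩

/-- The normalized Atiyah class `a(V) = -(1/2πi) b(V)`. -/
def normalizedAtiyahClass : EndFormH1 E F V :=
  (-(1 / (2 * (Real.pi : ℂ) * Complex.I))) • atiyahClass E F V

variable {E F V}

theorem contMDiffOn_trace {A : Π p, V p →L[ℂ] V p} {U : Set M} (hU : IsOpen U)
    (hA : IsHol E (F →L[ℂ] F) (fun p ↦ V p →L[ℂ] V p) A U) :
    ContMDiffOn 𝓘(ℂ, E) 𝓘(ℂ, ℂ) ω (fun p ↦ LinearMap.trace ℂ (V p) (A p)) U := by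
  intro x₀ hx₀
  apply ContMDiffAt.contMDiffWithinAt
  have h1 := ((contMDiffAt_hom_bundle _).1 (hA.contMDiffAt (hU.mem_nhds hx₀))).2
  let T : (F →L[ℂ] F) →L[ℂ] ℂ := LinearMap.toContinuousLinearMap
    ((LinearMap.trace ℂ F).comp (ContinuousLinearMap.coeLM ℂ))
  have h2 := (T.contDiff (n := ω)).contMDiff.contMDiffAt.comp x₀ h1
  refine h2.congr_of_eventuallyEq ?_
  have hxt : x₀ ∈ (trivializationAt F V x₀).baseSet := FiberBundle.mem_baseSet_trivializationAt' x₀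
  filter_upwards [(trivializationAt F V x₀).open_baseSet.mem_nhds hxt] with p hp
  simp only [Function.comp_apply]
  rw [ContinuousLinearMap.inCoordinates_eq hp hp]
  let e := ((trivializationAt F V x₀).continuousLinearEquivAt ℂ p hp).toLinearEquiv
  exact (LinearMap.trace_conj' (A p : V p →ₗ[ℂ] V p) e).symm

variable (E F V)

/-- The trace `Ω¹ ⊗ End V → Ω¹`, `A ↦ (v ↦ tr (A v))`. -/
def traceHom : HolBundleHom E (E →L[ℂ] (F →L[ℂ] F)) (EndForm E V) (E →L[ℂ] ℂ) (HolCotangent E) where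
  toFun p :=
    { toFun A := LinearMap.toContinuousLinearMap
        ((LinearMap.trace ℂ (V p)).comp ((ContinuousLinearMap.coeLM ℂ).comp (A : _ →ₗ[ℂ] _)))
      map_add' A B := by ext; simp
      map_smul' a B := by ext; simp }
  isHol U s hU hs := by
    refine IsHol.hom_of_apply hU fun W v hW hWU hv ↦ ?_
    exact IsHol.iff_contMDiffOn.2 (contMDiffOn_trace hW ((hs.mono hWU).hom_apply hv))

/-- The first Chern class of `V` in `H¹(M, Ω¹)`: the trace of the normalized Atiyah class. -/
def firstChernClass : CechH1 E (E →L[ℂ] ℂ) (HolCotangent E : M → Type _) :=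
  CechH1.map (traceHom E F V) (normalizedAtiyahClass E F V)

end Atiyah

section Det

variable {E : Type*} [NormedAddCommGroup E] [NormedSpace ℂ E]
  {M : Type*} [TopologicalSpace M] [ChartedSpace E M]
variable (F : Type*) [NormedAddCommGroup F] [NormedSpace ℂ F] [FiniteDimensional ℂ F]
  (V : M → Type*) [TopologicalSpace (TotalSpace F V)]
  [∀ x, AddCommGroup (V x)] [∀ x, Module ℂ (V x)] [∀ x, TopologicalSpace (V x)]
  [FiberBundle F V] [VectorBundle ℂ F V]

theorem contMDiff_det : ContMDiff 𝓘(ℂ, F →L[ℂ] F) 𝓘(ℂ, ℂ) ω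
    (fun A : F →L[ℂ] F ↦ A.det) := by
  rw [contMDiff_iff_contDiff]
  let b := Module.finBasis ℂ F
  have h : (fun A : F →L[ℂ] F ↦ A.det) =
      fun A : F →L[ℂ] F ↦ (LinearMap.toMatrix b b (A : F →ₗ[ℂ] F)).det := by
    ext A
    exact (LinearMap.det_toMatrix b _).symm
  simp only [h, Matrix.det_apply]
  refine ContDiff.sum fun σ _ ↦ ContDiff.const_smul _ (contDiff_prod fun i _ ↦ ?_)
  let l : (F →L[ℂ] F) →L[ℂ] ℂ := LinearMap.toContinuousLinearMap
    ((Matrix.entryLinearMap ℂ ℂ (σ i) i).comp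
      ((LinearMap.toMatrix b b).toLinearMap.comp (ContinuousLinearMap.coeLM ℂ)))
  exact l.contDiff

/-- The determinant line bundle `det V`, glued from the determinants of the transition functions
of `V`. -/
def detCore : VectorBundleCore ℂ M ℂ M where
  baseSet x := (trivializationAt F V x).baseSet
  isOpen_baseSet x := (trivializationAt F V x).open_baseSet
  indexAt x := x
  mem_baseSet_at x := FiberBundle.mem_baseSet_trivializationAt' x
  coordChange x y p := (transition F V y x p).det • ContinuousLinearMap.id ℂ ℂ
  coordChange_self x p hp v := by
    have : transition F V x x p = ContinuousLinearMap.id ℂ F := by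
      ext w
      rw [transition_apply F V hp hp, Trivialization.continuousLinearMapAt_symmL _ hp]
      rfl
    simp [this, ContinuousLinearMap.det]
  continuousOn_coordChange x y :=
    (ContinuousLinearMap.continuous_det.comp_continuousOn
      (continuousOn_coordChange ℂ (trivializationAt F V x) (trivializationAt F V y))).smul
      continuousOn_const
  coordChange_comp x y z p hp v := by
    have : transition F V z x p = (transition F V z y p).comp (transition F V y x p) := by
      ext w
      rw [ContinuousLinearMap.comp_apply, transition_apply F V hp.2 hp.1.1,
        transition_apply F V hp.2 hp.1.2, transition_apply F V hp.1.2 hp.1.1,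
        Trivialization.symmL_continuousLinearMapAt _ hp.1.2]
    simp [this, ContinuousLinearMap.det, mul_assoc]

instance [ContMDiffVectorBundle ω F V 𝓘(ℂ, E)] : (detCore F V).IsContMDiff 𝓘(ℂ, E) ω where
  contMDiffOn_coordChange x y := by
    have h := (contMDiff_det F).comp_contMDiffOn (contMDiffOn_coordChangeL (IB := 𝓘(ℂ, E)) (n := ω)
      (trivializationAt F V x) (trivializationAt F V y))
    exact h.smul contMDiffOn_const

/-- The fibres of the determinant line bundle `det V`. -/
abbrev DetBundle : M → Type _ := (detCore F V).Fiber

instance (p : M) : IsTopologicalAddGroup (DetBundle F V p) :=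
  (inferInstance : IsTopologicalAddGroup ℂ)

instance (p : M) : ContinuousSMul ℂ (DetBundle F V p) :=
  inferInstanceAs (ContinuousSMul ℂ ℂ)

end Det

section K
variable (E : Type*) [NormedAddCommGroup E] [NormedSpace ℂ E] [FiniteDimensional ℂ E]
  {M : Type*} [TopologicalSpace M] [ChartedSpace E M] [IsManifold 𝓘(ℂ, E) ω M]
/-- The canonical bundle `K_M = det Ω¹_M`. -/
abbrev CanonicalBundle : M → Type _ := DetBundle (E →L[ℂ] ℂ) (HolCotangent E : M → Type _)

variable (M)

/-- `c₁(K_M)` in `H¹(M, Ω¹)`. -/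
def c1K : CechH1 E (E →L[ℂ] ℂ) (HolCotangent E : M → Type _) :=
  firstChernClass E ℂ (CanonicalBundle E : M → Type _)
end K

section Conformal

variable {E : Type*} [NormedAddCommGroup E] [NormedSpace ℂ E]
  {M : Type*} [TopologicalSpace M] [ChartedSpace E M]

section TensorId

variable [FiniteDimensional ℂ E] [IsManifold 𝓘(ℂ, E) ω M]
  (F : Type*) [NormedAddCommGroup F] [NormedSpace ℂ F] [FiniteDimensional ℂ F]
  (V : M → Type*) [TopologicalSpace (TotalSpace F V)]
  [∀ x, AddCommGroup (V x)] [∀ x, Module ℂ (V x)] [∀ x, TopologicalSpace (V x)]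
  [∀ x, IsTopologicalAddGroup (V x)] [∀ x, ContinuousSMul ℂ (V x)]
  [FiberBundle F V] [VectorBundle ℂ F V] [ContMDiffVectorBundle ω F V 𝓘(ℂ, E)]

/-- The bundle homomorphism `Ω¹ → Ω¹ ⊗ End V`, `α ↦ α ⊗ id`. -/
def formTensorId :
    FormToEndForm E F V where
  toFun p :=
    { toFun α := α.smulRight (ContinuousLinearMap.id ℂ (V p))
      map_add' α β := by ext; simp [add_smul]
      map_smul' a α := by ext; simp [mul_smul] }
  isHol U s hU hs := by
    refine IsHol.hom_of_apply hU fun W v hW hWU hv ↦ ?_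
    refine IsHol.hom_of_apply hW fun W' e hW' hWU' he ↦ ?_
    exact IsHol.smul_fun (IsHol.iff_contMDiffOn.1
      ((hs.mono (hWU'.trans hWU)).hom_apply (hv.mono hWU'))) he

end TensorId

/-- The fibre at `p` of `α ↦ id ⊗ α`, where `id` is the identity section of `Ω¹ ⊗ T`: the value on
`v` is the endomorphism `η ↦ η(v) α`. -/
def idTensorFormAt [FiniteDimensional ℂ E] (p : M) :
    HolCotangent E p →ₗ[ℂ] EndForm E (HolCotangent E) p :=
    { toFun α := LinearMap.toContinuousLinearMap
        { toFun v := LinearMap.toContinuousLinearMap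
            { toFun η := η v • α
              map_add' η θ := by simp [add_smul]
              map_smul' a η := by simp [mul_smul] }
          map_add' v w := by ext; simp [add_mul]
          map_smul' a v := by ext; simp [mul_assoc] }
      map_add' α β := by ext; simp
      map_smul' a α := by ext; simp [mul_left_comm] }

theorem idTensorFormAt_apply [FiniteDimensional ℂ E] (p : M) (α : HolCotangent E p)
    (v : HolTangent E p) (η : HolCotangent E p) : idTensorFormAt p α v η = η v • α := rfl

variable (E M)

/-- The bundle homomorphism `Ω¹ → Ω¹ ⊗ T ⊗ Ω¹`, `α ↦ id ⊗ α`. -/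
def idTensorForm [FiniteDimensional ℂ E] [IsManifold 𝓘(ℂ, E) ω M] :
    FormToEndForm E (E →L[ℂ] ℂ) (HolCotangent E : M → Type _) where
  toFun p := idTensorFormAt p
  isHol U s hU hs := by
    refine IsHol.hom_of_apply hU fun W v hW hWU hv ↦ ?_
    refine IsHol.hom_of_apply hW fun W' η hW' hWU' hη ↦ ?_
    simp only [idTensorFormAt_apply]
    exact IsHol.smul_fun (IsHol.iff_contMDiffOn.1 (hη.hom_apply (hv.mono hWU')))
      (hs.mono (hWU'.trans hWU))

variable {M}
variable (L : M → Type*) [TopologicalSpace (TotalSpace ℂ L)] [∀ x, AddCommGroup (L x)]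
  [∀ x, Module ℂ (L x)] [∀ x, TopologicalSpace (L x)]
  [∀ x, IsTopologicalAddGroup (L x)] [∀ x, ContinuousSMul ℂ (L x)]
  [FiberBundle ℂ L] [VectorBundle ℂ ℂ L]

/-- A holomorphic conformal structure with values in the holomorphic line bundle `L`: a holomorphic
section of `S²Ω¹ ⊗ L`, non-degenerate at every point. -/
structure HolConformalStructure [IsManifold 𝓘(ℂ, E) ω M] where
  toFun : Π p : M, HolTangent E p →L[ℂ] (HolTangent E p →L[ℂ] L p)
  isHol : IsHol E (E →L[ℂ] (E →L[ℂ] ℂ))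
    (fun p ↦ HolTangent E p →L[ℂ] (HolTangent E p →L[ℂ] L p)) toFun univ
  symm : ∀ p v w, toFun p v w = toFun p w v
  nondegenerate : ∀ p v, (∀ w, toFun p v w = 0) → v = 0

section
variable {T L : Type*} [AddCommGroup T] [Module ℂ T] [TopologicalSpace T] [AddCommGroup L]
  [Module ℂ L] [TopologicalSpace L] [IsTopologicalAddGroup L] [ContinuousSMul ℂ L]
theorem smulRight_add_right (α : T →L[ℂ] ℂ) (x y : L) :
    α.smulRight (x + y) = α.smulRight x + α.smulRight y := by ext; simp
theorem smulRight_smul_right (α : T →L[ℂ] ℂ) (a : ℂ) (x : L) :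
    α.smulRight (a • x) = a • α.smulRight x := by
  ext t; exact smul_comm _ _ _
theorem smulRight_add_left (α β : T →L[ℂ] ℂ) (x : L) :
    (α + β).smulRight x = α.smulRight x + β.smulRight x := by ext; simp [add_smul]
theorem smulRight_smul_left (α : T →L[ℂ] ℂ) (a : ℂ) (x : L) :
    (a • α).smulRight x = a • α.smulRight x := by ext; simp [mul_smul]
end

variable {E L}
namespace HolConformalStructure
variable [FiniteDimensional ℂ E] [IsManifold 𝓘(ℂ, E) ω M] (g : HolConformalStructure E L)

theorem isInvertible_inCoordinates (p₀ p : M)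
    (hp : p ∈ (trivializationAt E (TangentSpace 𝓘(ℂ, E)) p₀).baseSet)
    (hp' : p ∈ (trivializationAt (E →L[ℂ] ℂ) (fun p ↦ HolTangent E p →L[ℂ] L p) p₀).baseSet) :
    (ContinuousLinearMap.inCoordinates E (TangentSpace 𝓘(ℂ, E)) (E →L[ℂ] ℂ)
      (fun p ↦ HolTangent E p →L[ℂ] L p) p₀ p p₀ p (g.toFun p)).IsInvertible := by
  set N := ContinuousLinearMap.inCoordinates E (TangentSpace 𝓘(ℂ, E)) (E →L[ℂ] ℂ)
      (fun p ↦ HolTangent E p →L[ℂ] L p) p₀ p p₀ p (g.toFun p) with hN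
  rw [ContinuousLinearMap.inCoordinates_eq hp hp'] at hN
  have hg : Function.Injective (g.toFun p) :=
    (injective_iff_map_eq_zero (g.toFun p)).2 fun v hv ↦ g.nondegenerate p v fun w ↦
      DFunLike.congr_fun hv w
  have hinj : Function.Injective N := by
    rw [hN]
    exact ((trivializationAt (E →L[ℂ] ℂ) (fun p ↦ HolTangent E p →L[ℂ] L p)
      p₀).continuousLinearEquivAt ℂ p hp').injective.comp (hg.comp
      ((trivializationAt E (TangentSpace 𝓘(ℂ, E)) p₀).continuousLinearEquivAt ℂ p
        hp).symm.injective)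
  have hdim : Module.finrank ℂ E = Module.finrank ℂ (E →L[ℂ] ℂ) := by
    rw [(LinearMap.toContinuousLinearMap (𝕜 := ℂ) (E := E) (F' := ℂ)).symm.finrank_eq]
    exact Subspace.dual_finrank_eq.symm
  let e := LinearEquiv.ofInjectiveOfFinrankEq N.toLinearMap hinj hdim
  exact ⟨e.toContinuousLinearEquiv, by ext v; rfl⟩

theorem isHol_inverse_apply {U : Set M} (hU : IsOpen U) {β : Π p, HolTangent E p →L[ℂ] L p}
    (hβ : IsHol E (E →L[ℂ] ℂ) (fun p ↦ HolTangent E p →L[ℂ] L p) β U) :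
    IsHol E E (HolTangent E) (fun p ↦ (g.toFun p).inverse (β p)) U := by
  intro p₀ hp₀
  apply ContMDiffAt.contMDiffWithinAt
  have hN := ((contMDiffAt_hom_bundle _).1 (g.isHol.contMDiffAt (x := p₀) Filter.univ_mem)).2
  have hb := (contMDiffAt_section _).1 (hβ.contMDiffAt (hU.mem_nhds hp₀))
  have h0 : p₀ ∈ (trivializationAt E (TangentSpace 𝓘(ℂ, E)) p₀).baseSet :=
    FiberBundle.mem_baseSet_trivializationAt' p₀
  have h0' : p₀ ∈ (trivializationAt (E →L[ℂ] ℂ) (fun p ↦ HolTangent E p →L[ℂ] L p) p₀).baseSet :=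
    FiberBundle.mem_baseSet_trivializationAt' p₀
  have hinv := ((g.isInvertible_inCoordinates p₀ p₀ h0 h0').contDiffAt_map_inverse
    (n := ω)).contMDiffAt.comp p₀ hN
  have h1 := hinv.clm_apply hb
  rw [contMDiffAt_section]
  refine h1.congr_of_eventuallyEq ?_
  filter_upwards [(trivializationAt E (TangentSpace 𝓘(ℂ, E)) p₀).open_baseSet.mem_nhds h0,
    (trivializationAt (E →L[ℂ] ℂ) (fun p ↦ HolTangent E p →L[ℂ] L p) p₀).open_baseSet.mem_nhds h0']
    with p hp hp'
  simp only [Function.comp_apply]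
  rw [ContinuousLinearMap.inCoordinates_eq hp hp', ContinuousLinearMap.inverse_equiv_comp,
    ContinuousLinearMap.inverse_comp_equiv]
  simp only [ContinuousLinearMap.comp_apply, ContinuousLinearEquiv.coe_coe,
    ContinuousLinearEquiv.symm_symm]
  have e1 := (trivializationAt (E →L[ℂ] ℂ) (fun p ↦ HolTangent E p →L[ℂ] L p)
    p₀).continuousLinearEquivAt_apply ℂ p hp'
  have e2 := (trivializationAt E (TangentSpace 𝓘(ℂ, E)) p₀).continuousLinearEquivAt_apply ℂ p hp
  rw [← congrFun e1 (β p), ContinuousLinearEquiv.symm_apply_apply, congrFun e2]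

/-- The fibre at `p` of `α ↦ g ⊗ g⁻¹(α)`, where `g` is read as an isomorphism `T ≅ Ω¹ ⊗ L`, so that
`g⁻¹(α)` lies in `T ⊗ L⁻¹` and `g ⊗ g⁻¹(α)` lies in `S²Ω¹ ⊗ T`: the value on `v`, `η` is the form
`w ↦ η (g⁻¹(α ⊗ g(v, w)))`. -/
def tensorInverseAt (p : M) : HolCotangent E p →ₗ[ℂ] EndForm E (HolCotangent E) p :=
    { toFun α := LinearMap.toContinuousLinearMap
        { toFun v := LinearMap.toContinuousLinearMap
            { toFun η := LinearMap.toContinuousLinearMap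
                { toFun w := η ((g.toFun p).inverse (α.smulRight (g.toFun p v w)))
                  map_add' w w' := by simp [smulRight_add_right]
                  map_smul' a w := by simp [smulRight_smul_right] }
              map_add' η θ := by ext; simp
              map_smul' a η := by ext; simp }
          map_add' v w := by ext; simp [smulRight_add_right]
          map_smul' a v := by ext; simp [smulRight_smul_right] }
      map_add' α β := by ext; simp [smulRight_add_left]
      map_smul' a α := by ext; simp [smulRight_smul_left] }

theorem tensorInverseAt_apply (p : M) (α : HolCotangent E p) (v : HolTangent E p)
    (η : HolCotangent E p) (w : HolTangent E p) :
    g.tensorInverseAt p α v η w =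
      η ((g.toFun p).inverse (ContinuousLinearMap.smulRight α (g.toFun p v w))) := rfl

/-- The bundle homomorphism `Ω¹ → Ω¹ ⊗ T ⊗ Ω¹`, `α ↦ g ⊗ g⁻¹(α)`. -/
def tensorInverse :
    FormToEndForm E (E →L[ℂ] ℂ) (HolCotangent E : M → Type _) where
  toFun p := g.tensorInverseAt p
  isHol U s hU hs := by
    refine IsHol.hom_of_apply hU fun W v hW hWU hv ↦ ?_
    refine IsHol.hom_of_apply hW fun W' η hW' hWU' hη ↦ ?_
    refine IsHol.hom_of_apply hW' fun W'' w hW'' hWU'' hw ↦ ?_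
    simp only [tensorInverseAt_apply]
    refine IsHol.hom_apply (hη.mono hWU'') (g.isHol_inverse_apply hW'' ?_)
    refine IsHol.hom_of_apply hW'' fun X u hX hXW hu ↦ ?_
    refine IsHol.smul_fun (IsHol.iff_contMDiffOn.1
      ((hs.mono ((hXW.trans hWU'').trans (hWU'.trans hWU))).hom_apply hu)) ?_
    exact ((g.isHol.mono (subset_univ _)).hom_apply
      (hv.mono ((hXW.trans hWU'').trans hWU'))).hom_apply (hw.mono hXW)

end HolConformalStructure
end Conformal
end

/-! ### Čech classes: comparing representatives. -/

section Cohomology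

variable {E : Type*} [NormedAddCommGroup E] [NormedSpace ℂ E]
  {M : Type*} [TopologicalSpace M] [ChartedSpace E M]
  {F : Type*} [NormedAddCommGroup F] [NormedSpace ℂ F]
  {V : M → Type*} [TopologicalSpace (TotalSpace F V)]
  [∀ x, AddCommGroup (V x)] [∀ x, Module ℂ (V x)] [∀ x, TopologicalSpace (V x)]
  [FiberBundle F V] [VectorBundle ℂ F V]
  {F' : Type*} [NormedAddCommGroup F'] [NormedSpace ℂ F']
  {V' : M → Type*} [TopologicalSpace (TotalSpace F' V')]
  [∀ x, AddCommGroup (V' x)] [∀ x, Module ℂ (V' x)] [∀ x, TopologicalSpace (V' x)]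
  [FiberBundle F' V'] [VectorBundle ℂ F' V']

/-! Where `L` is trivialized, `g` becomes an honest holomorphic metric and has a Levi-Civita
connection, given in a chart by Christoffel symbols Γ_x. Were these connections to agree on
overlaps, they would glue to a global one and the Atiyah class would vanish. Passing from x to y
does two things. The change of coordinates adds to Γ the Atiyah cochain of T, i.e. the second
derivatives of the coordinate change. The change of frame of `L` rescales the metric conformally,
which adds half of Φ(α) = α ⊗ id + id ⊗ α - g ⊗ g⁻¹(α), read on T, where α is the logarithmic
derivative of the transition function of `L`. This is `christoffel_transition`.

Transposed to Ω¹, it says that b(Ω¹) + (1/2) Φ(tr b(L)) is the coboundary of the 0-cochain -Γ, hence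
b(Ω¹) = -(1/2) Φ(tr b(L)) in H¹ (`atiyahClass_cotangent`).

It remains to eliminate `L`. The three terms of Φ(α) have traces mα, α and α, so tr Φ(α) = mα
(`trace_weyl`). Taking traces gives tr b(Ω¹) = -(m/2) tr b(L). Since c₁(Ω¹) = c₁(K_M) by Jacobi's
formula for the derivative of a determinant (`firstChernClass_detBundle`), -(1/2) c₁(L) may be
replaced by c₁(K_M)/m, and this is the formula. -/

theorem CechH1.mk_eq_mk {c d : cechCocycles E F V} {U : M → Set M} (hU : IsPointedCover U)
    (h : IsCoboundaryOn E F V U (c.1 - d.1)) : CechH1.mk E F V c = CechH1.mk E F V d :=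
  (Submodule.Quotient.eq _).2 (show (c - d : cechCocycles E F V).1 ∈ cechCoboundaries E F V from
    ⟨U, hU, h⟩)

theorem CechH1.mk_congr {c d : cechCocycles E F V} {U : M → Set M} (hU : IsPointedCover U)
    (h : ∀ x y, ∀ p ∈ U x ∩ U y, c.1 x y p = d.1 x y p) :
    CechH1.mk E F V c = CechH1.mk E F V d :=
  CechH1.mk_eq_mk hU ⟨0, fun _ ↦ IsHol.zero _, fun x y p hp ↦ by simp [h x y p hp]⟩

theorem CechH1.map_mk (φ : HolBundleHom E F V F' V') (c : cechCocycles E F V) :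
    CechH1.map φ (CechH1.mk E F V c) =
      CechH1.mk E F' V' ⟨φ.cochainMap c.1, φ.mapsTo_cocycles c.1 c.2⟩ := rfl

theorem CechH1.mk_surjective : Function.Surjective (CechH1.mk E F V) :=
  Submodule.mkQ_surjective _

/-- Disposes of the zero-dimensional case at the end. -/
theorem CechH1.subsingleton (h : ∀ p, Subsingleton (V p)) : Subsingleton (CechH1 E F V) :=
  ⟨fun a b ↦ by
    obtain ⟨a, rfl⟩ := CechH1.mk_surjective a
    obtain ⟨b, rfl⟩ := CechH1.mk_surjective b
    congr 1
    ext x y p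
    exact Subsingleton.elim _ _⟩

end Cohomology

/-! ### Transition functions and trivializations of Hom bundles. -/

section Transition

variable {M : Type*} [TopologicalSpace M]
  (F : Type*) [NormedAddCommGroup F] [NormedSpace ℂ F]
  (V : M → Type*) [TopologicalSpace (TotalSpace F V)]
  [∀ x, AddCommGroup (V x)] [∀ x, Module ℂ (V x)] [∀ x, TopologicalSpace (V x)]
  [FiberBundle F V] [VectorBundle ℂ F V]

theorem transition_comp_self {x y q : M} (hx : q ∈ (trivializationAt F V x).baseSet)
    (hy : q ∈ (trivializationAt F V y).baseSet) :
    (transition F V y x q).comp (transition F V x y q) = ContinuousLinearMap.id ℂ F := by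
  ext w
  rw [ContinuousLinearMap.comp_apply, transition_apply F V hx hy, transition_apply F V hy hx,
    Trivialization.symmL_continuousLinearMapAt _ hx, Trivialization.continuousLinearMapAt_symmL _ hy]
  rfl

variable (F' : Type*) [NormedAddCommGroup F'] [NormedSpace ℂ F']
  (V' : M → Type*) [TopologicalSpace (TotalSpace F' V')]
  [∀ x, AddCommGroup (V' x)] [∀ x, Module ℂ (V' x)] [∀ x, TopologicalSpace (V' x)]
  [∀ x, IsTopologicalAddGroup (V' x)] [∀ x, ContinuousSMul ℂ (V' x)]
  [FiberBundle F' V'] [VectorBundle ℂ F' V']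

/-- Serves both for Ω¹ = Hom(T, ℂ) and, applied twice, for Hom(T, Hom(T, L)), where `g` lives. -/
theorem hom_continuousLinearMapAt {x q : M} (hx : q ∈ (trivializationAt F V x).baseSet)
    (hx' : q ∈ (trivializationAt F' V' x).baseSet) (φ : V q →L[ℂ] V' q) :
    (trivializationAt (F →L[ℂ] F') (fun q ↦ V q →L[ℂ] V' q) x).continuousLinearMapAt ℂ q φ =
      ((trivializationAt F' V' x).continuousLinearMapAt ℂ q).comp
        (φ.comp ((trivializationAt F V x).symmL ℂ q)) := by
  have h : q ∈ (trivializationAt (F →L[ℂ] F') (fun q ↦ V q →L[ℂ] V' q) x).baseSet := ⟨hx, hx'⟩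
  rw [Trivialization.continuousLinearMapAt_apply_of_mem ℂ _ h]
  rfl

theorem hom_symmL {x q : M} (hx : q ∈ (trivializationAt F V x).baseSet)
    (hx' : q ∈ (trivializationAt F' V' x).baseSet) (ξ : F →L[ℂ] F') :
    (trivializationAt (F →L[ℂ] F') (fun q ↦ V q →L[ℂ] V' q) x).symmL ℂ q ξ =
      ((trivializationAt F' V' x).symmL ℂ q).comp
        (ξ.comp ((trivializationAt F V x).continuousLinearMapAt ℂ q)) := by
  have h : q ∈ (trivializationAt (F →L[ℂ] F') (fun q ↦ V q →L[ℂ] V' q) x).baseSet := ⟨hx, hx'⟩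
  rw [← Trivialization.symmL_continuousLinearMapAt (R := ℂ) _ h
    (((trivializationAt F' V' x).symmL ℂ q).comp
        (ξ.comp ((trivializationAt F V x).continuousLinearMapAt ℂ q))),
    hom_continuousLinearMapAt F V F' V' hx hx']
  congr 1
  ext v
  simp [Trivialization.continuousLinearMapAt_symmL _ hx,
    Trivialization.continuousLinearMapAt_symmL _ hx']

end Transition

/-! ### Differentiation of vector-valued functions, and Jacobi's formula. -/

section Derivative

variable {E : Type*} [NormedAddCommGroup E] [NormedSpace ℂ E]
  {M : Type*} [TopologicalSpace M] [ChartedSpace E M]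
  {F : Type*} [NormedAddCommGroup F] [NormedSpace ℂ F]
  {F' : Type*} [NormedAddCommGroup F'] [NormedSpace ℂ F']

/-- The derivative at `p` of a vector-valued function along a tangent vector. -/
noncomputable def derivAlong (f : M → F) {p : M} (v : HolTangent E p) : F :=
  mfderiv 𝓘(ℂ, E) 𝓘(ℂ, F) f p v

theorem derivAlong_add (f : M → F) {p : M} (v w : HolTangent E p) :
    derivAlong f (v + w) = derivAlong f v + derivAlong f w :=
  map_add (mfderiv 𝓘(ℂ, E) 𝓘(ℂ, F) f p) v w

theorem derivAlong_smul (f : M → F) {p : M} (a : ℂ) (v : HolTangent E p) :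
    derivAlong f (a • v) = a • derivAlong f v :=
  map_smul (mfderiv 𝓘(ℂ, E) 𝓘(ℂ, F) f p) a v

theorem Filter.EventuallyEq.derivAlong_eq {f f' : M → F} {p : M} (h : f =ᶠ[𝓝 p] f')
    (v : HolTangent E p) : derivAlong f v = derivAlong f' v :=
  DFunLike.congr_fun (h.mfderiv_eq (I := 𝓘(ℂ, E)) (I' := 𝓘(ℂ, F))) v

theorem derivAlong_clm_comp (Λ : F →L[ℂ] F') {f : M → F} {p : M}
    (hf : MDifferentiableAt 𝓘(ℂ, E) 𝓘(ℂ, F) f p) (v : HolTangent E p) :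
    derivAlong (fun q ↦ Λ (f q)) v = Λ (derivAlong f v) :=
  DFunLike.congr_fun (HasMFDerivAt.comp p (Λ.hasMFDerivAt (x := f p)) hf.hasMFDerivAt).mfderiv v

theorem derivAlong_comp {h : F → F'} {f : M → F} {p : M} (hh : DifferentiableAt ℂ h (f p))
    (hf : MDifferentiableAt 𝓘(ℂ, E) 𝓘(ℂ, F) f p) (v : HolTangent E p) :
    derivAlong (fun q ↦ h (f q)) v = fderiv ℂ h (f p) (derivAlong f v) :=
  DFunLike.congr_fun
    (HasMFDerivAt.comp p hh.hasFDerivAt.hasMFDerivAt hf.hasMFDerivAt).mfderiv v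

theorem derivAlong_clm_apply {c : M → F →L[ℂ] F'} {u : M → F} {p : M}
    (hc : MDifferentiableAt 𝓘(ℂ, E) 𝓘(ℂ, F →L[ℂ] F') c p)
    (hu : MDifferentiableAt 𝓘(ℂ, E) 𝓘(ℂ, F) u p) (v : HolTangent E p) :
    derivAlong (fun q ↦ c q (u q)) v = c p (derivAlong u v) + derivAlong c v (u p) := by
  have h : HasMFDerivAt 𝓘(ℂ, E) 𝓘(ℂ, F') (fun q ↦ c q (u q)) p _ :=
    ⟨hc.hasMFDerivAt.1.clm_apply hu.hasMFDerivAt.1, by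
      simpa only [mfld_simps] using! hc.hasMFDerivAt.2.clm_apply hu.hasMFDerivAt.2⟩
  exact DFunLike.congr_fun h.mfderiv v

variable [FiniteDimensional ℂ F]

theorem fderiv_det_id (A : F →L[ℂ] F) :
    fderiv ℂ (fun A : F →L[ℂ] F ↦ A.det) (ContinuousLinearMap.id ℂ F) A =
      LinearMap.trace ℂ F A := by
  have hd : Differentiable ℂ (fun A : F →L[ℂ] F ↦ A.det) :=
    (contMDiff_iff_contDiff.1 (contMDiff_det F)).differentiable (by simp)
  have h1 : HasDerivAt (fun s : ℂ ↦ ContinuousLinearMap.id ℂ F + s • A) A 0 := by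
    simpa using ((hasDerivAt_id (0 : ℂ)).smul_const A).const_add (ContinuousLinearMap.id ℂ F)
  have h2 := HasFDerivAt.comp_hasDerivAt_of_eq (0 : ℂ)
    (hd (ContinuousLinearMap.id ℂ F)).hasFDerivAt h1 (by simp)
  let b := Module.finBasis ℂ F
  let N := LinearMap.toMatrix b b (A : F →ₗ[ℂ] F)
  -- The derivative is read off along the line s ↦ 1 + sA: the linear coefficient of det(1 + sN) is
  -- tr N, and the remainder P(s)s² has zero derivative at 0.
  obtain ⟨P, hP⟩ : ∃ P : Polynomial ℂ, ∀ s : ℂ, (1 + s • N).det =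
      1 + N.trace * s + P.eval s * s ^ 2 := ⟨_, fun s ↦ Matrix.det_one_add_smul s N⟩
  have h3 : ((fun A : F →L[ℂ] F ↦ A.det) ∘ fun s : ℂ ↦ ContinuousLinearMap.id ℂ F + s • A) =
      fun s ↦ 1 + N.trace * s + P.eval s * s ^ 2 := by
    funext s
    rw [← hP]
    refine (LinearMap.det_toMatrix b _).symm.trans ?_
    congr 1
    simp [N]
  rw [h3] at h2
  have h4 : HasDerivAt (fun s : ℂ ↦ 1 + N.trace * s + P.eval s * s ^ 2) N.trace 0 := by
    have h5 := (((hasDerivAt_id (0 : ℂ)).const_mul N.trace).const_add 1).add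
      ((P.hasDerivAt (0 : ℂ)).mul (hasDerivAt_pow 2 (0 : ℂ)))
    simpa using! h5
  rw [h2.unique h4, LinearMap.trace_eq_matrix_trace ℂ b]

/-- Jacobi's formula for the derivative of a determinant. -/
theorem derivAlong_det {t : M → F →L[ℂ] F} {p : M}
    (ht : MDifferentiableAt 𝓘(ℂ, E) 𝓘(ℂ, F →L[ℂ] F) t p) {S : F →L[ℂ] F}
    (hS : S.comp (t p) = ContinuousLinearMap.id ℂ F) (v : HolTangent E p) :
    S.det * derivAlong (fun q ↦ (t q).det) v =
      LinearMap.trace ℂ F (S.comp (derivAlong t v)) := by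
  have hd : Differentiable ℂ (fun A : F →L[ℂ] F ↦ A.det) :=
    (contMDiff_iff_contDiff.1 (contMDiff_det F)).differentiable (by simp)
  -- Multiplying by S on the left moves the value at p to the identity, where the derivative of det
  -- is the trace; multiplicativity of det turns this into the constant factor det S.
  let Λ : (F →L[ℂ] F) →L[ℂ] (F →L[ℂ] F) := ContinuousLinearMap.postcomp F S
  have hΛt : MDifferentiableAt 𝓘(ℂ, E) 𝓘(ℂ, F →L[ℂ] F) (fun q ↦ Λ (t q)) p :=
    Λ.mdifferentiableAt.comp p ht
  have hdt : MDifferentiableAt 𝓘(ℂ, E) 𝓘(ℂ, ℂ) (fun q ↦ (t q).det) p :=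
    (hd (t p)).mdifferentiableAt.comp p ht
  have h1 := derivAlong_clm_comp (ContinuousLinearMap.mul ℂ ℂ S.det) hdt v
  rw [ContinuousLinearMap.mul_apply'] at h1
  rw [← h1]
  have h2 : (fun q ↦ ContinuousLinearMap.mul ℂ ℂ S.det (t q).det) =
      (fun A : F →L[ℂ] F ↦ A.det) ∘ fun q ↦ Λ (t q) := by
    funext q
    simp [Λ, ContinuousLinearMap.det]
  have h3 : Λ (t p) = ContinuousLinearMap.id ℂ F := hS
  rw [h2, derivAlong, mfderiv_comp p (hd (Λ (t p))).mdifferentiableAt hΛt, mfderiv_eq_fderiv, h3]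
  refine (fderiv_det_id _).trans ?_
  have h4 := derivAlong_clm_comp Λ ht v
  exact congrArg (fun A : F →L[ℂ] F ↦ LinearMap.trace ℂ F A) h4

end Derivative

/-! ### The trace of the Atiyah cochain and the determinant bundle. -/

section AtiyahTrace

variable {E : Type*} [NormedAddCommGroup E] [NormedSpace ℂ E] [FiniteDimensional ℂ E]
  {M : Type*} [TopologicalSpace M] [ChartedSpace E M] [IsManifold 𝓘(ℂ, E) ω M]
  (F : Type*) [NormedAddCommGroup F] [NormedSpace ℂ F] [FiniteDimensional ℂ F]
  (V : M → Type*) [TopologicalSpace (TotalSpace F V)]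
  [∀ x, AddCommGroup (V x)] [∀ x, Module ℂ (V x)] [∀ x, TopologicalSpace (V x)]
  [∀ x, IsTopologicalAddGroup (V x)] [∀ x, ContinuousSMul ℂ (V x)]
  [FiberBundle F V] [VectorBundle ℂ F V] [ContMDiffVectorBundle ω F V 𝓘(ℂ, E)]

theorem mdifferentiableAt_transition {x y p : M}
    (hx : p ∈ (trivializationAt F V x).baseSet) (hy : p ∈ (trivializationAt F V y).baseSet) :
    MDifferentiableAt 𝓘(ℂ, E) 𝓘(ℂ, F →L[ℂ] F) (transition F V x y) p :=
  (contMDiffAt_coordChangeL (n := ω) hy hx).mdifferentiableAt (by simp)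

/-- Conjugation by the y-th trivialization turns the cochain into the matrix t_yx dt_xy. -/
theorem trace_atiyahCochain {x y p : M}
    (hx : p ∈ (trivializationAt F V x).baseSet) (hy : p ∈ (trivializationAt F V y).baseSet)
    (v : HolTangent E p) :
    LinearMap.trace ℂ (V p) (atiyahCochain E F V x y p v) =
      LinearMap.trace ℂ F ((transition F V y x p).comp (dTransition E F V x y p v)) := by
  let e := ((trivializationAt F V y).continuousLinearEquivAt ℂ p hy).toLinearEquiv
  rw [← LinearMap.trace_conj' _ e]
  congr 1
  ext w
  have h1 : e.symm w = (trivializationAt F V y).symmL ℂ p w := by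
    rw [← Trivialization.symm_continuousLinearEquivAt_eq _ hy]
    rfl
  have h2 : ∀ u, e u = (trivializationAt F V y).continuousLinearMapAt ℂ p u := fun u ↦ by
    rw [Trivialization.continuousLinearMapAt_apply_of_mem ℂ _ hy]
    rfl
  simp only [LinearEquiv.conj_apply_apply, ContinuousLinearMap.coe_coe, h1, h2,
    atiyahCochain_apply, Trivialization.continuousLinearMapAt_symmL _ hy,
    ContinuousLinearMap.comp_apply]
  rw [transition_apply F V hy hx]

theorem transition_detBundle {x y q : M} (hx : q ∈ (trivializationAt F V x).baseSet)
    (hy : q ∈ (trivializationAt F V y).baseSet) :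
    transition ℂ (DetBundle F V) x y q =
      (transition F V x y q).det • ContinuousLinearMap.id ℂ ℂ := by
  ext
  -- The indices are swapped because `coordChange` goes from its first index to its second,
  -- `transition` from its second to its first.
  exact (detCore F V).trivializationAt_coordChange_eq (b₀ := y) (b₁ := x) ⟨hy, hx⟩ 1

theorem dTransition_detBundle {x y p : M} (hx : p ∈ (trivializationAt F V x).baseSet)
    (hy : p ∈ (trivializationAt F V y).baseSet) (v : HolTangent E p) :
    dTransition E ℂ (DetBundle F V) x y p v =
      derivAlong (fun q ↦ (transition F V x y q).det) v •
        ContinuousLinearMap.id ℂ ℂ := by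
  let Λ : ℂ →L[ℂ] (ℂ →L[ℂ] ℂ) :=
    ContinuousLinearMap.toSpanSingleton ℂ (ContinuousLinearMap.id ℂ ℂ)
  have hd : Differentiable ℂ (fun A : F →L[ℂ] F ↦ A.det) :=
    (contMDiff_iff_contDiff.1 (contMDiff_det F)).differentiable (by simp)
  have h1 : transition ℂ (DetBundle F V) x y =ᶠ[𝓝 p]
      fun q ↦ Λ (transition F V x y q).det := by
    filter_upwards [(trivializationAt F V x).open_baseSet.mem_nhds hx,
      (trivializationAt F V y).open_baseSet.mem_nhds hy] with q h h'
    exact transition_detBundle F V h h'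
  have h2 : MDifferentiableAt 𝓘(ℂ, E) 𝓘(ℂ, ℂ) (fun q ↦ (transition F V x y q).det) p :=
    (hd _).mdifferentiableAt.comp p (mdifferentiableAt_transition F V hx hy)
  exact (h1.derivAlong_eq v).trans
    (derivAlong_clm_comp Λ h2 v)

/-- Both sides are d log det t_xy, by Jacobi's formula. The two first Chern classes thus agree
already on cochains. -/
theorem trace_atiyahCochain_detBundle {x y p : M} (hx : p ∈ (trivializationAt F V x).baseSet)
    (hy : p ∈ (trivializationAt F V y).baseSet) (v : HolTangent E p) :
    LinearMap.trace ℂ (DetBundle F V p) (atiyahCochain E ℂ (DetBundle F V) x y p v) =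
      LinearMap.trace ℂ (V p) (atiyahCochain E F V x y p v) := by
  rw [trace_atiyahCochain ℂ (DetBundle F V) hx hy, trace_atiyahCochain F V hx hy,
    transition_detBundle F V hy hx, dTransition_detBundle F V hx hy]
  refine Eq.trans ?_ (derivAlong_det (mdifferentiableAt_transition F V hx hy)
    (transition_comp_self F V hx hy) v)
  rw [ContinuousLinearMap.smul_comp, ContinuousLinearMap.id_comp, smul_smul,
    ContinuousLinearMap.toLinearMap_smul, map_smul, ContinuousLinearMap.coe_id,
    LinearMap.trace_id]
  simp

/-- A vector bundle and its determinant have the same first Chern class. -/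
theorem firstChernClass_detBundle :
    firstChernClass E ℂ (DetBundle F V) = firstChernClass E F V := by
  simp only [firstChernClass, normalizedAtiyahClass, map_smul, atiyahClass, CechH1.map_mk]
  congr 1
  refine CechH1.mk_congr (U := fun x ↦ (trivializationAt F V x).baseSet)
    (fun x ↦ ⟨(trivializationAt F V x).open_baseSet,
      FiberBundle.mem_baseSet_trivializationAt' x⟩) fun x y p hp ↦ ?_
  ext v
  exact trace_atiyahCochain_detBundle F V hp.1 hp.2 v

end AtiyahTrace

/-! ### Atiyah cochains of the tangent and cotangent bundles. -/

section Tangent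

variable {E : Type*} [NormedAddCommGroup E] [NormedSpace ℂ E] [FiniteDimensional ℂ E]
  {M : Type*} [TopologicalSpace M] [ChartedSpace E M] [IsManifold 𝓘(ℂ, E) ω M]

theorem transition_tangent {x y q : M} (hx : q ∈ (trivializationAt E (HolTangent E) x).baseSet)
    (hy : q ∈ (trivializationAt E (HolTangent E) y).baseSet) :
    transition E (HolTangent E) x y q =
      fderiv ℂ (extChartAt 𝓘(ℂ, E) x ∘ (extChartAt 𝓘(ℂ, E) y).symm) (extChartAt 𝓘(ℂ, E) y q) := by
  have h : transition E (HolTangent E) x y q = tangentCoordChange 𝓘(ℂ, E) y x q := by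
    ext w
    exact (tangentBundleCore 𝓘(ℂ, E) M).trivializationAt_coordChange_eq (b₀ := y) (b₁ := x)
      ⟨hy, hx⟩ w
  rw [h, tangentCoordChange_def, ModelWithCorners.range_eq_univ, fderivWithin_univ]

/-- The Atiyah cochain of the tangent bundle is symmetric, being given by the second derivatives of
the coordinate changes. -/
theorem atiyahCochain_tangent_symm {x y p : M}
    (hx : p ∈ (trivializationAt E (HolTangent E) x).baseSet)
    (hy : p ∈ (trivializationAt E (HolTangent E) y).baseSet) (v w : HolTangent E p) :
    atiyahCochain E E (HolTangent E) x y p v w = atiyahCochain E E (HolTangent E) x y p w v := by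
  set ψ := extChartAt 𝓘(ℂ, E) x ∘ (extChartAt 𝓘(ℂ, E) y).symm with hψ
  set φ := extChartAt 𝓘(ℂ, E) y with hφ
  have hx' : p ∈ (extChartAt 𝓘(ℂ, E) x).source := by
    rw [extChartAt_source]; exact hx
  have hy' : p ∈ φ.source := by
    rw [extChartAt_source]; exact hy
  have hψd : ContDiffAt ℂ ω ψ (φ p) := by
    have h1 := contDiffWithinAt_ext_coord_change (I := 𝓘(ℂ, E)) (n := ω) x y (y := φ p)
      ⟨φ.map_source hy', show φ.symm (φ p) ∈ (extChartAt 𝓘(ℂ, E) x).source by rwa [φ.left_inv hy']⟩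
    rwa [ModelWithCorners.range_eq_univ, contDiffWithinAt_univ] at h1
  have hd : DifferentiableAt ℂ (fderiv ℂ ψ) (φ p) :=
    (hψd.fderiv_right (m := 1) (by simp)).differentiableAt (by simp)
  have hφd : MDifferentiableAt 𝓘(ℂ, E) 𝓘(ℂ, E) φ p := mdifferentiableAt_extChartAt hy
  have h1 : transition E (HolTangent E) x y =ᶠ[𝓝 p] fun q ↦ fderiv ℂ ψ (φ q) := by
    filter_upwards [(trivializationAt E (HolTangent E) x).open_baseSet.mem_nhds hx,
      (trivializationAt E (HolTangent E) y).open_baseSet.mem_nhds hy] with q h h'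
    exact transition_tangent h h'
  -- Chain rule for Dψ ∘ φ: since dφ is the y-th trivialization of T, the cochain is D²ψ in the
  -- coordinates of y, and its symmetry is that of second derivatives.
  have h2 : ∀ u : HolTangent E p, dTransition E E (HolTangent E) x y p u =
      fderiv ℂ (fderiv ℂ ψ) (φ p)
        ((trivializationAt E (HolTangent E) y).continuousLinearMapAt ℂ p u) := by
    intro u
    rw [TangentBundle.continuousLinearMapAt_trivializationAt hy]
    exact (h1.derivAlong_eq u).trans (derivAlong_comp hd hφd u)
  simp only [atiyahCochain_apply, h2]
  rw [(hψd.isSymmSndFDerivAt (by simp)).eq]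

theorem mem_baseSet_cotangent {x q : M}
    (hx : q ∈ (trivializationAt E (HolTangent E) x).baseSet) :
    q ∈ (trivializationAt (E →L[ℂ] ℂ) (HolCotangent E : M → Type _) x).baseSet :=
  ⟨hx, mem_univ _⟩

theorem cotangent_continuousLinearMapAt {x q : M}
    (hx : q ∈ (trivializationAt E (HolTangent E) x).baseSet) (η : HolCotangent E q) :
    (trivializationAt (E →L[ℂ] ℂ) (HolCotangent E) x).continuousLinearMapAt ℂ q η =
      η.comp ((trivializationAt E (HolTangent E) x).symmL ℂ q) := by
  rw [hom_continuousLinearMapAt E (HolTangent E) ℂ (fun _ ↦ ℂ) hx (mem_univ _)]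
  ext v
  simp

theorem cotangent_symmL {x q : M}
    (hx : q ∈ (trivializationAt E (HolTangent E) x).baseSet) (ξ : E →L[ℂ] ℂ) :
    (trivializationAt (E →L[ℂ] ℂ) (HolCotangent E) x).symmL ℂ q ξ =
      ξ.comp ((trivializationAt E (HolTangent E) x).continuousLinearMapAt ℂ q) := by
  rw [hom_symmL E (HolTangent E) ℂ (fun _ ↦ ℂ) hx (mem_univ _)]
  ext v
  simp

/-- Transition functions of the dual are contragredient: precomposition with the tangent transition
in the opposite direction. This depends linearly on the latter, so it commutes with differentiation.
Hence x and y change places. -/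
theorem dTransition_cotangent {x y p : M}
    (hx : p ∈ (trivializationAt E (HolTangent E) x).baseSet)
    (hy : p ∈ (trivializationAt E (HolTangent E) y).baseSet) (v : HolTangent E p)
    (ξ : E →L[ℂ] ℂ) :
    dTransition E (E →L[ℂ] ℂ) (HolCotangent E) x y p v ξ =
      ξ.comp (dTransition E E (HolTangent E) y x p v) := by
  let Λ : (E →L[ℂ] E) →L[ℂ] ((E →L[ℂ] ℂ) →L[ℂ] (E →L[ℂ] ℂ)) :=
    (ContinuousLinearMap.compL ℂ E E ℂ).flip
  have h1 : transition (E →L[ℂ] ℂ) (HolCotangent E) x y =ᶠ[𝓝 p]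
      fun q ↦ Λ (transition E (HolTangent E) y x q) := by
    filter_upwards [(trivializationAt E (HolTangent E) x).open_baseSet.mem_nhds hx,
      (trivializationAt E (HolTangent E) y).open_baseSet.mem_nhds hy] with q h h'
    ext ζ w
    rw [transition_apply _ _ (mem_baseSet_cotangent h) (mem_baseSet_cotangent h'),
      cotangent_continuousLinearMapAt h, cotangent_symmL h']
    simp only [Λ, ContinuousLinearMap.flip_apply, ContinuousLinearMap.compL_apply,
      ContinuousLinearMap.comp_apply]
    rw [transition_apply _ _ h' h]
  exact DFunLike.congr_fun ((h1.derivAlong_eq v).trans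
    (derivAlong_clm_comp Λ (mdifferentiableAt_transition E (HolTangent E) hy hx) v)) ξ

/-- The Atiyah cochain of the cotangent bundle is the transpose of that of the tangent bundle. -/
theorem atiyahCochain_cotangent {x y p : M}
    (hx : p ∈ (trivializationAt E (HolTangent E) x).baseSet)
    (hy : p ∈ (trivializationAt E (HolTangent E) y).baseSet) (v w : HolTangent E p)
    (η : HolCotangent E p) :
    atiyahCochain E (E →L[ℂ] ℂ) (HolCotangent E) x y p v η w =
      η (atiyahCochain E E (HolTangent E) y x p v w) := by
  rw [atiyahCochain_apply, cotangent_continuousLinearMapAt hy, cotangent_symmL hx,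
    dTransition_cotangent hx hy]
  rfl

end Tangent

/-! ### The local metrics and their Christoffel symbols. -/

namespace HolConformalStructure

variable {E : Type*} [NormedAddCommGroup E] [NormedSpace ℂ E] [FiniteDimensional ℂ E]
  {M : Type*} [TopologicalSpace M] [ChartedSpace E M] [IsManifold 𝓘(ℂ, E) ω M]
  {L : M → Type*} [TopologicalSpace (TotalSpace ℂ L)] [∀ p, AddCommGroup (L p)]
  [∀ p, Module ℂ (L p)] [∀ p, TopologicalSpace (L p)] [∀ p, IsTopologicalAddGroup (L p)]
  [∀ p, ContinuousSMul ℂ (L p)] [FiberBundle ℂ L] [VectorBundle ℂ ℂ L]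
  (g : HolConformalStructure E L)

theorem isInvertible (p : M) : (g.toFun p).IsInvertible := by
  have h0 : p ∈ (trivializationAt E (TangentSpace 𝓘(ℂ, E)) p).baseSet :=
    FiberBundle.mem_baseSet_trivializationAt' p
  have h0' : p ∈ (trivializationAt (E →L[ℂ] ℂ) (fun p ↦ HolTangent E p →L[ℂ] L p) p).baseSet :=
    FiberBundle.mem_baseSet_trivializationAt' p
  have h := g.isInvertible_inCoordinates p p h0 h0'
  rwa [ContinuousLinearMap.inCoordinates_eq h0 h0', ContinuousLinearMap.isInvertible_equiv_comp,
    ContinuousLinearMap.isInvertible_comp_equiv] at h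

theorem apply_inverse (p : M) (β : HolTangent E p →L[ℂ] L p) :
    g.toFun p ((g.toFun p).inverse β) = β := by
  obtain ⟨e, he⟩ := g.isInvertible p
  rw [← he, ContinuousLinearMap.inverse_equiv]
  exact e.apply_symm_apply β

/-- Lets identities between Christoffel symbols be checked after lowering an index, where they
become identities between Koszul forms. -/
theorem ext_of_apply {p : M} {v w : HolTangent E p} (h : ∀ z, g.toFun p v z = g.toFun p w z) :
    v = w :=
  sub_eq_zero.1 (g.nondegenerate p _ fun z ↦ by simp [h z])

/-- The coefficients of `g` in the distinguished local trivializations at `x`. -/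
noncomputable def coeff (x q : M) : E →L[ℂ] (E →L[ℂ] ℂ) :=
  (trivializationAt (E →L[ℂ] (E →L[ℂ] ℂ))
    (fun p ↦ HolTangent E p →L[ℂ] (HolTangent E p →L[ℂ] L p)) x).continuousLinearMapAt ℂ q
      (g.toFun q)

theorem coeff_apply {x q : M} (hT : q ∈ (trivializationAt E (HolTangent E) x).baseSet)
    (hL : q ∈ (trivializationAt ℂ L x).baseSet) (a b : E) :
    g.coeff x q a b = (trivializationAt ℂ L x).continuousLinearMapAt ℂ q
      (g.toFun q ((trivializationAt E (HolTangent E) x).symmL ℂ q a)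
        ((trivializationAt E (HolTangent E) x).symmL ℂ q b)) := by
  have h : q ∈ (trivializationAt (E →L[ℂ] ℂ) (fun p ↦ HolTangent E p →L[ℂ] L p) x).baseSet :=
    ⟨hT, hL⟩
  rw [coeff, hom_continuousLinearMapAt E (HolTangent E) (E →L[ℂ] ℂ)
    (fun p ↦ HolTangent E p →L[ℂ] L p) hT h]
  simp only [ContinuousLinearMap.comp_apply]
  rw [hom_continuousLinearMapAt E (HolTangent E) ℂ L hT hL]
  rfl

variable (E L) in
/-- The common domain of the distinguished local trivializations of `T` and `L` at `x`. -/
noncomputable def chartDomain (x : M) : Set M :=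
  (trivializationAt E (HolTangent E) x).baseSet ∩ (trivializationAt ℂ L x).baseSet

variable (E L) in
theorem isPointedCover_chartDomain : IsPointedCover (chartDomain E L : M → Set M) := fun x ↦
  ⟨(trivializationAt E (HolTangent E) x).open_baseSet.inter
    (trivializationAt ℂ L x).open_baseSet, FiberBundle.mem_baseSet_trivializationAt' x,
    FiberBundle.mem_baseSet_trivializationAt' x⟩

/-- The Koszul form of `g` in the trivializations at `x`, the Christoffel symbols of the first
kind. -/
noncomputable def koszul (x p : M) (v w : HolTangent E p) : HolCotangent E p :=
  let t := (trivializationAt E (HolTangent E) x).continuousLinearMapAt ℂ p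
  LinearMap.toContinuousLinearMap
    -- Koszul's formula for fields with constant coefficients in the chart at x. Such fields
    -- commute, so no bracket terms appear.
    { toFun z := (1 / 2 : ℂ) * (derivAlong (g.coeff x) v (t w) (t z) +
        derivAlong (g.coeff x) w (t v) (t z) - derivAlong (g.coeff x) z (t v) (t w))
      map_add' z z' := by simp [derivAlong_add]; ring
      map_smul' a z := by simp [derivAlong_smul]; ring }

theorem koszul_apply (x p : M) (v w z : HolTangent E p) :
    g.koszul x p v w z = (1 / 2 : ℂ) *
      (derivAlong (g.coeff x) v
          ((trivializationAt E (HolTangent E) x).continuousLinearMapAt ℂ p w)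
          ((trivializationAt E (HolTangent E) x).continuousLinearMapAt ℂ p z) +
        derivAlong (g.coeff x) w
          ((trivializationAt E (HolTangent E) x).continuousLinearMapAt ℂ p v)
          ((trivializationAt E (HolTangent E) x).continuousLinearMapAt ℂ p z) -
        derivAlong (g.coeff x) z
          ((trivializationAt E (HolTangent E) x).continuousLinearMapAt ℂ p v)
          ((trivializationAt E (HolTangent E) x).continuousLinearMapAt ℂ p w)) := rfl

/-- The Christoffel symbols of the local metric obtained from `g` by trivializing `L` at `x`. -/
noncomputable def christoffel (x p : M) (v w : HolTangent E p) : HolTangent E p :=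
  (g.toFun p).inverse
    -- The frame of `L` at x supplies the factor in `L` that g⁻¹ : Ω¹ ⊗ L → T needs.
    ((g.koszul x p v w).smulRight ((trivializationAt ℂ L x).symmL ℂ p 1))

theorem apply_christoffel (x p : M) (v w z : HolTangent E p) :
    g.toFun p (g.christoffel x p v w) z =
      g.koszul x p v w z • (trivializationAt ℂ L x).symmL ℂ p 1 := by
  rw [christoffel, g.apply_inverse]
  rfl

/-- The transposed Christoffel symbols, as a 1-form with values in `End Ω¹`. -/
noncomputable def christoffelForm (x p : M) : EndForm E (HolCotangent E : M → Type _) p :=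
  LinearMap.toContinuousLinearMap
    { toFun v := LinearMap.toContinuousLinearMap
        { toFun η := LinearMap.toContinuousLinearMap
            { toFun w := η (g.christoffel x p v w)
              map_add' w w' := by
                rw [← map_add]
                congr 1
                refine g.ext_of_apply fun z ↦ ?_
                simp only [map_add, derivAlong_add, _root_.add_apply, apply_christoffel, ← add_smul, koszul_apply]
                congr 1
                ring
              map_smul' a w := by
                rw [← map_smul]
                congr 1
                refine g.ext_of_apply fun z ↦ ?_
                simp only [map_smul, derivAlong_smul, _root_.smul_apply, apply_christoffel, smul_smul, koszul_apply,
                  smul_eq_mul, RingHom.id_apply]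
                congr 1
                ring }
          map_add' η θ := by ext; simp
          map_smul' a η := by ext; simp }
      map_add' v v' := by
        ext η w
        simp only [LinearMap.coe_toContinuousLinearMap', LinearMap.coe_mk, AddHom.coe_mk,
          _root_.add_apply]
        rw [← map_add]
        congr 1
        refine g.ext_of_apply fun z ↦ ?_
        simp only [map_add, derivAlong_add, _root_.add_apply, apply_christoffel, ← add_smul, koszul_apply]
        congr 1
        ring
      map_smul' a v := by
        ext η w
        simp only [LinearMap.coe_toContinuousLinearMap', LinearMap.coe_mk, AddHom.coe_mk,
          _root_.smul_apply]
        rw [RingHom.id_apply, ← map_smul]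
        congr 1
        refine g.ext_of_apply fun z ↦ ?_
        simp only [map_smul, derivAlong_smul, _root_.smul_apply, apply_christoffel, smul_smul, koszul_apply,
          smul_eq_mul]
        congr 1
        ring }

theorem christoffelForm_apply (x p : M) (v w : HolTangent E p) (η : HolCotangent E p) :
    g.christoffelForm x p v η w = η (g.christoffel x p v w) := rfl

end HolConformalStructure

/-! ### Logarithmic derivatives of line bundle transition functions. -/

section LineBundle

theorem continuousLinearMap_apply_eq_mul (A : ℂ →L[ℂ] ℂ) (z : ℂ) : A z = A 1 * z := by
  rw [mul_comm, ← smul_eq_mul, ← map_smul, smul_eq_mul, mul_one]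

theorem trace_continuousLinearMap_self (A : ℂ →L[ℂ] ℂ) : LinearMap.trace ℂ ℂ A = A 1 := by
  have h : (A : ℂ →ₗ[ℂ] ℂ) = A 1 • LinearMap.id := by
    ext
    simp
  rw [h, map_smul, LinearMap.trace_id]
  simp

variable {E : Type*} [NormedAddCommGroup E] [NormedSpace ℂ E] [FiniteDimensional ℂ E]
  {M : Type*} [TopologicalSpace M] [ChartedSpace E M] [IsManifold 𝓘(ℂ, E) ω M]
  (L : M → Type*) [TopologicalSpace (TotalSpace ℂ L)] [∀ p, AddCommGroup (L p)]
  [∀ p, Module ℂ (L p)] [∀ p, TopologicalSpace (L p)] [∀ p, IsTopologicalAddGroup (L p)]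
  [∀ p, ContinuousSMul ℂ (L p)] [FiberBundle ℂ L] [VectorBundle ℂ ℂ L]
  [ContMDiffVectorBundle ω ℂ L 𝓘(ℂ, E)]

/-- The logarithmic derivative of the transition function `t_{xy}` of a line bundle. -/
noncomputable def dlogTransition (x y p : M) : HolCotangent E p :=
  (traceHom E ℂ L).toFun p (atiyahCochain E ℂ L x y p)

theorem dlogTransition_apply (x y p : M) (v : HolTangent E p) :
    dlogTransition L x y p v = LinearMap.trace ℂ (L p) (atiyahCochain E ℂ L x y p v) := rfl

theorem transition_mul_self {x y p : M} (hx : p ∈ (trivializationAt ℂ L x).baseSet)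
    (hy : p ∈ (trivializationAt ℂ L y).baseSet) :
    transition ℂ L x y p 1 * transition ℂ L y x p 1 = 1 := by
  rw [← continuousLinearMap_apply_eq_mul]
  exact DFunLike.congr_fun (transition_comp_self ℂ L hy hx) 1

theorem dTransition_eq_mul_dlog {x y p : M} (hx : p ∈ (trivializationAt ℂ L x).baseSet)
    (hy : p ∈ (trivializationAt ℂ L y).baseSet) (v : HolTangent E p) :
    dTransition E ℂ L x y p v 1 = transition ℂ L x y p 1 * dlogTransition L x y p v := by
  rw [dlogTransition_apply, trace_atiyahCochain ℂ L hx hy, trace_continuousLinearMap_self,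
    ContinuousLinearMap.comp_apply, continuousLinearMap_apply_eq_mul (transition ℂ L y x p),
    ← mul_assoc, transition_mul_self L hx hy, one_mul]

end LineBundle

/-! ### Transformation of the Christoffel symbols. -/

namespace HolConformalStructure

variable {E : Type*} [NormedAddCommGroup E] [NormedSpace ℂ E] [FiniteDimensional ℂ E]
  {M : Type*} [TopologicalSpace M] [ChartedSpace E M] [IsManifold 𝓘(ℂ, E) ω M]
  {L : M → Type*} [TopologicalSpace (TotalSpace ℂ L)] [∀ p, AddCommGroup (L p)]
  [∀ p, Module ℂ (L p)] [∀ p, TopologicalSpace (L p)] [∀ p, IsTopologicalAddGroup (L p)]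
  [∀ p, ContinuousSMul ℂ (L p)] [FiberBundle ℂ L] [VectorBundle ℂ ℂ L]
  [ContMDiffVectorBundle ω ℂ L 𝓘(ℂ, E)] (g : HolConformalStructure E L)

theorem contMDiffOn_coeff (x : M) :
    ContMDiffOn 𝓘(ℂ, E) 𝓘(ℂ, E →L[ℂ] (E →L[ℂ] ℂ)) ω (g.coeff x) (chartDomain E L x) := by
  let e := trivializationAt (E →L[ℂ] (E →L[ℂ] ℂ))
    (fun p ↦ HolTangent E p →L[ℂ] (HolTangent E p →L[ℂ] L p)) x
  have hs : chartDomain E L x ⊆ e.baseSet := fun q hq ↦ ⟨hq.1, hq.1, hq.2⟩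
  refine ((e.contMDiffOn_section_iff (isPointedCover_chartDomain E L x).1 hs).1
    (g.isHol.mono (subset_univ _))).congr fun q hq ↦ ?_
  exact Trivialization.continuousLinearMapAt_apply_of_mem ℂ e (hs hq) _

theorem mdifferentiableAt_coeff {x p : M} (hp : p ∈ chartDomain E L x) :
    MDifferentiableAt 𝓘(ℂ, E) 𝓘(ℂ, E →L[ℂ] (E →L[ℂ] ℂ)) (g.coeff x) p :=
  ((g.contMDiffOn_coeff x).contMDiffAt
    ((isPointedCover_chartDomain E L x).1.mem_nhds hp)).mdifferentiableAt (by simp)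

/-- The change of chart acts through the Jacobian, and the change of frame of `L` is a conformal
rescaling. Differentiating this product is the source of every correction term below. -/
theorem coeff_transition {x y q : M} (hx : q ∈ chartDomain E L x) (hy : q ∈ chartDomain E L y)
    (a b : E) :
    g.coeff y q a b = transition ℂ L y x q
      (g.coeff x q (transition E (HolTangent E) x y q a) (transition E (HolTangent E) x y q b)) := by
  rw [g.coeff_apply hx.1 hx.2, g.coeff_apply hy.1 hy.2, transition_apply _ _ hy.2 hx.2,
    transition_apply _ _ hx.1 hy.1, transition_apply _ _ hx.1 hy.1]
  simp only [Trivialization.symmL_continuousLinearMapAt _ hx.1,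
    Trivialization.symmL_continuousLinearMapAt _ hx.2]

theorem coeff_tangent {x p : M} (hp : p ∈ chartDomain E L x) (v w : HolTangent E p) :
    g.coeff x p ((trivializationAt E (HolTangent E) x).continuousLinearMapAt ℂ p v)
        ((trivializationAt E (HolTangent E) x).continuousLinearMapAt ℂ p w) =
      (trivializationAt ℂ L x).continuousLinearMapAt ℂ p (g.toFun p v w) := by
  rw [g.coeff_apply hp.1 hp.2]
  simp only [Trivialization.symmL_continuousLinearMapAt _ hp.1]

/-- The change of the derivatives of the coefficients of `g` under a change of trivializations. -/
theorem derivAlong_coeff {x y p : M} (hx : p ∈ chartDomain E L x) (hy : p ∈ chartDomain E L y)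
    (v w z : HolTangent E p) :
    derivAlong (g.coeff y) v
        ((trivializationAt E (HolTangent E) y).continuousLinearMapAt ℂ p w)
        ((trivializationAt E (HolTangent E) y).continuousLinearMapAt ℂ p z) =
      transition ℂ L y x p 1 *
        (derivAlong (g.coeff x) v
            ((trivializationAt E (HolTangent E) x).continuousLinearMapAt ℂ p w)
            ((trivializationAt E (HolTangent E) x).continuousLinearMapAt ℂ p z) +
          (trivializationAt ℂ L x).continuousLinearMapAt ℂ p
            (g.toFun p (atiyahCochain E E (HolTangent E) x y p v w) z) +
          (trivializationAt ℂ L x).continuousLinearMapAt ℂ p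
            (g.toFun p w (atiyahCochain E E (HolTangent E) x y p v z)) +
          dlogTransition L y x p v *
            (trivializationAt ℂ L x).continuousLinearMapAt ℂ p (g.toFun p w z)) := by
  set tx := trivializationAt E (HolTangent E) x with htx
  set ty := trivializationAt E (HolTangent E) y with hty
  set J := transition E (HolTangent E) x y with hJ
  set a := ty.continuousLinearMapAt ℂ p w with ha
  set b := ty.continuousLinearMapAt ℂ p z with hb
  have hJd := mdifferentiableAt_transition (E := E) E (HolTangent E) hx.1 hy.1
  have hTd := mdifferentiableAt_transition (E := E) ℂ L hy.2 hx.2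
  have hcx := g.mdifferentiableAt_coeff hx
  have hcy := g.mdifferentiableAt_coeff hy
  have hconst : ∀ u : E, MDifferentiableAt 𝓘(ℂ, E) 𝓘(ℂ, E) (fun q ↦ J q u) p := fun u ↦
    hJd.clm_apply mdifferentiableAt_const
  have hdJ : ∀ u, derivAlong (fun q ↦ J q u) v = derivAlong J v u := fun u ↦
    derivAlong_clm_comp (ContinuousLinearMap.apply ℂ E u) hJd v
  -- The coordinates a, b at y are frozen, so that the product rule applies to a scalar function; in
  -- the coordinates of x these vectors vary through the Jacobian J.
  have h1 : derivAlong (g.coeff y) v a b = derivAlong (fun q ↦ g.coeff y q a b) v := by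
    let Λ : (E →L[ℂ] (E →L[ℂ] ℂ)) →L[ℂ] ℂ :=
      (ContinuousLinearMap.apply ℂ ℂ b).comp (ContinuousLinearMap.apply ℂ (E →L[ℂ] ℂ) a)
    exact (derivAlong_clm_comp Λ hcy v).symm
  have h2 : (fun q ↦ g.coeff y q a b) =ᶠ[𝓝 p]
      fun q ↦ transition ℂ L y x q (g.coeff x q (J q a) (J q b)) := by
    filter_upwards [(isPointedCover_chartDomain E L x).1.mem_nhds hx,
      (isPointedCover_chartDomain E L y).1.mem_nhds hy] with q h h'
    exact g.coeff_transition h h' a b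
  have hdT : ∀ u : HolTangent E p, derivAlong J v (ty.continuousLinearMapAt ℂ p u) =
      tx.continuousLinearMapAt ℂ p (atiyahCochain E E (HolTangent E) x y p v u) := by
    intro u
    rw [atiyahCochain_apply, Trivialization.continuousLinearMapAt_symmL _ hx.1]
    rfl
  have hJt : ∀ u : HolTangent E p, J p (ty.continuousLinearMapAt ℂ p u) =
      tx.continuousLinearMapAt ℂ p u := by
    intro u
    rw [hJ, transition_apply _ _ hx.1 hy.1, Trivialization.symmL_continuousLinearMapAt _ hy.1]
  have h3 : derivAlong (transition ℂ L y x) v 1 =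
      transition ℂ L y x p 1 * dlogTransition L y x p v := dTransition_eq_mul_dlog L hy.2 hx.2 v
  rw [h1, h2.derivAlong_eq v, derivAlong_clm_apply hTd ((hcx.clm_apply (hconst a)).clm_apply
    (hconst b)), derivAlong_clm_apply (hcx.clm_apply (hconst a)) (hconst b),
    derivAlong_clm_apply hcx (hconst a), hdJ, hdJ, ha, hb, hdT, hdT, hJt, hJt,
    continuousLinearMap_apply_eq_mul (transition ℂ L y x p),
    continuousLinearMap_apply_eq_mul (derivAlong (transition ℂ L y x) v), h3,
    _root_.add_apply, g.coeff_tangent hx, g.coeff_tangent hx, g.coeff_tangent hx]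
  ring

/-- Of the six terms containing the Atiyah cochain A of T, the symmetry of A and of `g` cancels
four; the other two are both g(A(v, w), z), which absorbs the factor 1/2. The logarithmic derivative
terms do not cancel and give the conformal correction. -/
theorem koszul_transition {x y p : M} (hx : p ∈ chartDomain E L x)
    (hy : p ∈ chartDomain E L y) (v w z : HolTangent E p) :
    g.koszul y p v w z = transition ℂ L y x p 1 * (g.koszul x p v w z +
      (trivializationAt ℂ L x).continuousLinearMapAt ℂ p
        (g.toFun p (atiyahCochain E E (HolTangent E) x y p v w) z) +
      (1 / 2 : ℂ) *
        (dlogTransition L y x p v *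
            (trivializationAt ℂ L x).continuousLinearMapAt ℂ p (g.toFun p w z) +
          dlogTransition L y x p w *
            (trivializationAt ℂ L x).continuousLinearMapAt ℂ p (g.toFun p v z) -
          dlogTransition L y x p z *
            (trivializationAt ℂ L x).continuousLinearMapAt ℂ p (g.toFun p v w))) := by
  have hs := fun u u' ↦ atiyahCochain_tangent_symm hx.1 hy.1 u u'
  simp only [koszul_apply, g.derivAlong_coeff hx hy]
  rw [hs w v, hs z v, hs z w, g.symm p (atiyahCochain E E (HolTangent E) x y p v z) w]
  ring

/-- The change of the Christoffel symbols under a change of trivializations. -/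
theorem christoffel_transition {x y p : M} (hx : p ∈ chartDomain E L x)
    (hy : p ∈ chartDomain E L y) (v w : HolTangent E p) :
    g.christoffel y p v w = g.christoffel x p v w + atiyahCochain E E (HolTangent E) x y p v w +
      (1 / 2 : ℂ) • (dlogTransition L y x p v • w + dlogTransition L y x p w • v -
        (g.toFun p).inverse (ContinuousLinearMap.smulRight (dlogTransition L y x p)
          (g.toFun p v w))) := by
  refine g.ext_of_apply fun z ↦ ?_
  let e := (trivializationAt ℂ L x).continuousLinearEquivAt ℂ p hx.2
  have he : ∀ l, e l = (trivializationAt ℂ L x).continuousLinearMapAt ℂ p l := fun l ↦ by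
    rw [Trivialization.continuousLinearMapAt_apply_of_mem ℂ _ hx.2]
    rfl
  have hf := transition_mul_self L hx.2 hy.2
  apply e.injective
  simp only [map_add, map_sub, map_smul, _root_.add_apply, _root_.sub_apply, _root_.smul_apply,
    apply_inverse, apply_christoffel, ContinuousLinearMap.smulRight_apply, he, smul_eq_mul]
  -- Seen in the trivialization at x, the frame of `L` at y is t_xy(1), which cancels the factor
  -- t_yx(1) in the change of the Koszul form.
  rw [Trivialization.continuousLinearMapAt_symmL _ hx.2, ← transition_apply ℂ L hx.2 hy.2]
  rw [g.koszul_transition hx hy, mul_right_comm, mul_comm (transition ℂ L y x p 1), hf, one_mul,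
    mul_one]

end HolConformalStructure

/-! ### The identity of Atiyah classes and its trace. -/

namespace HolConformalStructure

variable {E : Type*} [NormedAddCommGroup E] [NormedSpace ℂ E] [FiniteDimensional ℂ E]
  {M : Type*} [TopologicalSpace M] [ChartedSpace E M] [IsManifold 𝓘(ℂ, E) ω M]
  {L : M → Type*} [TopologicalSpace (TotalSpace ℂ L)] [∀ p, AddCommGroup (L p)]
  [∀ p, Module ℂ (L p)] [∀ p, TopologicalSpace (L p)] [∀ p, IsTopologicalAddGroup (L p)]
  [∀ p, ContinuousSMul ℂ (L p)] [FiberBundle ℂ L] [VectorBundle ℂ ℂ L]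
  [ContMDiffVectorBundle ω ℂ L 𝓘(ℂ, E)] (g : HolConformalStructure E L)

theorem contMDiffOn_derivAlong_coeff {x : M} {W : Set M} (hW : IsOpen W)
    (hWx : W ⊆ chartDomain E L x) {u v w : Π p : M, HolTangent E p}
    (hu : IsHol E E (HolTangent E) u W) (hv : IsHol E E (HolTangent E) v W)
    (hw : IsHol E E (HolTangent E) w W) :
    ContMDiffOn 𝓘(ℂ, E) 𝓘(ℂ, ℂ) ω (fun p ↦ derivAlong (g.coeff x) (u p)
      ((trivializationAt E (HolTangent E) x).continuousLinearMapAt ℂ p (v p))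
      ((trivializationAt E (HolTangent E) x).continuousLinearMapAt ℂ p (w p))) W := by
  have ht : ∀ {s : Π p : M, HolTangent E p}, IsHol E E (HolTangent E) s W →
      ContMDiffOn 𝓘(ℂ, E) 𝓘(ℂ, E) ω (fun p ↦
        (trivializationAt E (HolTangent E) x).continuousLinearMapAt ℂ p (s p)) W := by
    intro s hs
    refine (((trivializationAt E (HolTangent E) x).contMDiffOn_section_iff hW
      (hWx.trans inter_subset_left)).1 hs).congr fun p hp ↦ ?_
    exact Trivialization.continuousLinearMapAt_apply_of_mem ℂ _ (hWx hp).1 _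
  exact ((contMDiffOn_mfderiv_apply hW ((g.contMDiffOn_coeff x).mono hWx) hu).clm_apply
    (ht hv)).clm_apply (ht hw)

/-- Makes the Christoffel symbols an admissible 0-cochain: they are built from derivatives of
holomorphic coefficients and the holomorphic inverse of `g`. -/
theorem isHol_christoffelForm (x : M) :
    IsHol E (E →L[ℂ] ((E →L[ℂ] ℂ) →L[ℂ] (E →L[ℂ] ℂ))) (EndForm E (HolCotangent E))
      (g.christoffelForm x) (chartDomain E L x) := by
  refine IsHol.hom_of_apply (isPointedCover_chartDomain E L x).1 fun W₁ v hW₁ h₁ hv ↦ ?_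
  refine IsHol.hom_of_apply hW₁ fun W₂ η hW₂ h₂ hη ↦ ?_
  refine IsHol.hom_of_apply hW₂ fun W₃ w hW₃ h₃ hw ↦ ?_
  simp only [christoffelForm_apply]
  refine IsHol.hom_apply (hη.mono h₃) (g.isHol_inverse_apply hW₃ ?_)
  refine IsHol.hom_of_apply hW₃ fun W z hW h₄ hz ↦ ?_
  have hWx : W ⊆ chartDomain E L x := h₄.trans (h₃.trans (h₂.trans h₁))
  have hv' := hv.mono (h₄.trans (h₃.trans h₂))
  have hw' := hw.mono h₄
  refine IsHol.smul_fun (f := fun p ↦ g.koszul x p (v p) (w p) (z p)) ?_ ?_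
  · simp only [koszul_apply]
    exact contMDiffOn_const.mul (((g.contMDiffOn_derivAlong_coeff hW hWx hv' hw' hz).add
      (g.contMDiffOn_derivAlong_coeff hW hWx hw' hv' hz)).sub
      (g.contMDiffOn_derivAlong_coeff hW hWx hz hv' hw'))
  · refine ((trivializationAt ℂ L x).contMDiffOn_section_iff hW
      (hWx.trans inter_subset_right)).2 ((contMDiffOn_const (c := (1 : ℂ))).congr fun p hp ↦ ?_)
    rw [← Trivialization.continuousLinearMapAt_apply_of_mem ℂ _ (hWx hp).2,
      Trivialization.continuousLinearMapAt_symmL _ (hWx hp).2]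

/-- The map `Ω¹ → Ω¹ ⊗ End Ω¹`, `α ↦ α ⊗ id + id ⊗ α - g ⊗ g⁻¹(α)`, on `H¹`. -/
noncomputable def weylMap : CechH1 E (E →L[ℂ] ℂ) (HolCotangent E : M → Type _) →ₗ[ℂ]
    EndFormH1 E (E →L[ℂ] ℂ) (HolCotangent E : M → Type _) :=
  CechH1.map (formTensorId (E →L[ℂ] ℂ) (HolCotangent E)) + CechH1.map (idTensorForm E M) -
    CechH1.map g.tensorInverse

/-- The trace of `α ↦ α ⊗ id + id ⊗ α - g ⊗ g⁻¹(α)` on the fibre at `p`. -/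
theorem trace_weyl (p : M) (α : HolCotangent E p) (v : HolTangent E p) :
    LinearMap.trace ℂ (HolCotangent E p)
        ((formTensorId (E →L[ℂ] ℂ) (HolCotangent E)).toFun p α v :
          HolCotangent E p →L[ℂ] HolCotangent E p) +
      LinearMap.trace ℂ (HolCotangent E p)
        (idTensorFormAt p α v : HolCotangent E p →L[ℂ] HolCotangent E p) -
      LinearMap.trace ℂ (HolCotangent E p)
        (g.tensorInverseAt p α v : HolCotangent E p →L[ℂ] HolCotangent E p) =
      (Module.finrank ℂ E : ℂ) * α v := by
  have h1 : LinearMap.trace ℂ (HolCotangent E p)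
      ((formTensorId (E →L[ℂ] ℂ) (HolCotangent E)).toFun p α v :
        HolCotangent E p →L[ℂ] HolCotangent E p) = (Module.finrank ℂ E : ℂ) * α v := by
    have h : (((formTensorId (E →L[ℂ] ℂ) (HolCotangent E)).toFun p α v :
        HolCotangent E p →L[ℂ] HolCotangent E p) : HolCotangent E p →ₗ[ℂ] HolCotangent E p) =
        α v • LinearMap.id := rfl
    have hdim : Module.finrank ℂ (HolCotangent E p) = Module.finrank ℂ E := by
      rw [(LinearMap.toContinuousLinearMap (𝕜 := ℂ) (E := HolTangent E p)
        (F' := ℂ)).symm.finrank_eq]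
      exact Subspace.dual_finrank_eq
    rw [h, map_smul, LinearMap.trace_id, hdim, smul_eq_mul, mul_comm]
  have h2 : LinearMap.trace ℂ (HolCotangent E p)
      (idTensorFormAt p α v : HolCotangent E p →L[ℂ] HolCotangent E p) = α v :=
    LinearMap.trace_smulRight (M := HolCotangent E p)
      { toFun η := η v
        map_add' η θ := rfl
        map_smul' a η := rfl } α
  have hp := FiberBundle.mem_baseSet_trivializationAt' (F := ℂ) (E := L) p
  let e := (trivializationAt ℂ L p).continuousLinearEquivAt ℂ p hp
  -- With L_p identified with ℂ, γ = g(v, ·) and G = g⁻¹(α). The third endomorphism is then η ↦ η(G)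
  -- γ, of rank at most one, with trace γ(G) = g(v, G) = g(G, v) = α(v).
  let γ : HolCotangent E p := (e : L p →L[ℂ] ℂ).comp (g.toFun p v)
  let G : HolTangent E p := (g.toFun p).inverse (α.smulRight (e.symm 1))
  have h3 : LinearMap.trace ℂ (HolCotangent E p)
      (g.tensorInverseAt p α v : HolCotangent E p →L[ℂ] HolCotangent E p) = α v := by
    have h : ((g.tensorInverseAt p α v : HolCotangent E p →L[ℂ] HolCotangent E p) :
        HolCotangent E p →ₗ[ℂ] HolCotangent E p) =
        LinearMap.smulRight (M := HolCotangent E p)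
          { toFun η := η G
            map_add' η θ := rfl
            map_smul' a η := rfl } γ := by
      refine LinearMap.ext fun η ↦ ContinuousLinearMap.ext fun w ↦ ?_
      have h4 : g.toFun p v w = γ w • e.symm 1 := by
        rw [← map_smul, smul_eq_mul, mul_one]
        exact (e.symm_apply_apply _).symm
      have h5 : η ((g.toFun p).inverse (ContinuousLinearMap.smulRight α (g.toFun p v w))) =
          η G * γ w := by
        rw [h4, smulRight_smul_right, map_smul, map_smul, smul_eq_mul, mul_comm]
      exact h5
    rw [h, LinearMap.trace_smulRight]
    have h6 : e (g.toFun p v G) = α v := by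
      rw [g.symm, g.apply_inverse, ContinuousLinearMap.smulRight_apply, map_smul,
        e.apply_symm_apply, smul_eq_mul, mul_one]
    exact h6
  rw [h1, h2, h3]
  ring

theorem map_traceHom_weylMap (β : CechH1 E (E →L[ℂ] ℂ) (HolCotangent E : M → Type _)) :
    CechH1.map (traceHom E (E →L[ℂ] ℂ) (HolCotangent E)) (g.weylMap β) =
      (Module.finrank ℂ E : ℂ) • β := by
  obtain ⟨c, rfl⟩ := CechH1.mk_surjective β
  simp only [weylMap, LinearMap.sub_apply, LinearMap.add_apply, map_add, map_sub, CechH1.map_mk]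
  rw [← map_add, ← map_sub, ← map_smul]
  refine CechH1.mk_congr (U := fun _ ↦ univ) (fun _ ↦ ⟨isOpen_univ, mem_univ _⟩)
    fun x y p _ ↦ ?_
  ext v
  exact g.trace_weyl p (c.1 x y p) v

/-- The Atiyah class of `Ω¹` in terms of the Atiyah class of the line bundle `L`. -/
theorem atiyahClass_cotangent :
    atiyahClass E (E →L[ℂ] ℂ) (HolCotangent E : M → Type _) =
      (-(1 / 2) : ℂ) • g.weylMap (CechH1.map (traceHom E ℂ L) (atiyahClass E ℂ L)) := by
  simp only [weylMap, LinearMap.sub_apply, LinearMap.add_apply, atiyahClass, CechH1.map_mk]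
  rw [← map_add, ← map_sub, ← map_smul]
  refine CechH1.mk_eq_mk (isPointedCover_chartDomain E L)
    -- The sign fits the convention c_xy = b_y - b_x for coboundaries.
    ⟨fun x ↦ (-1 : ℂ) • g.christoffelForm x, fun x ↦ (g.isHol_christoffelForm x).smul _,
      fun x y p hp ↦ ?_⟩
  ext v η w
  -- Used from y to x: the cochain of Ω¹ at (x, y) is the transpose of that of T at (y, x), and the
  -- logarithmic derivative that appears is then the one at (x, y).
  have h := congrArg η (g.christoffel_transition hp.2 hp.1 v w)
  simp only [map_add, map_sub, map_smul, smul_eq_mul] at h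
  have h1 : atiyahCochain E (E →L[ℂ] ℂ) (HolCotangent E) x y p v η w -
      (-(1 / 2) : ℂ) * (dlogTransition L x y p v * η w + η v * dlogTransition L x y p w -
        η ((g.toFun p).inverse (ContinuousLinearMap.smulRight (dlogTransition L x y p)
          (g.toFun p v w)))) =
      (-1 : ℂ) * η (g.christoffel y p v w) - (-1 : ℂ) * η (g.christoffel x p v w) := by
    rw [atiyahCochain_cotangent hp.1.1 hp.2.1, h]
    ring
  exact h1

end HolConformalStructure

theorem mainTheorem8 {E : Type*} [NormedAddCommGroup E] [NormedSpace ℂ E] [FiniteDimensional ℂ E]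
    {M : Type*} [TopologicalSpace M] [ChartedSpace E M] [IsManifold 𝓘(ℂ, E) ω M]
    {L : M → Type*} [TopologicalSpace (TotalSpace ℂ L)] [∀ p, AddCommGroup (L p)]
    [∀ p, Module ℂ (L p)] [∀ p, TopologicalSpace (L p)] [∀ p, IsTopologicalAddGroup (L p)]
    [∀ p, ContinuousSMul ℂ (L p)] [FiberBundle ℂ L] [VectorBundle ℂ ℂ L]
    [ContMDiffVectorBundle ω ℂ L 𝓘(ℂ, E)] (g : HolConformalStructure E L) :
    normalizedAtiyahClass E (E →L[ℂ] ℂ) (HolCotangent E : M → Type _) =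
      CechH1.map (formTensorId (E →L[ℂ] ℂ) (HolCotangent E))
          ((1 / (Module.finrank ℂ E : ℂ)) • c1K E M) +
        CechH1.map (idTensorForm E M) ((1 / (Module.finrank ℂ E : ℂ)) • c1K E M) -
        CechH1.map g.tensorInverse ((1 / (Module.finrank ℂ E : ℂ)) • c1K E M) := by
  -- In dimension 0 the factor 1/m takes the default value 0, but the tangent spaces vanish, so both
  -- sides lie in a zero group.
  rcases Nat.eq_zero_or_pos (Module.finrank ℂ E) with hm | hm
  · have hE : Subsingleton E := Module.finrank_zero_iff.1 hm
    have h : ∀ p : M, Subsingleton (EndForm E (HolCotangent E : M → Type _) p) := fun p ↦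
      ⟨fun A B ↦ ContinuousLinearMap.ext fun v ↦ by
        have hv : v = 0 := Subsingleton.elim (α := E) v 0
        rw [hv, map_zero, map_zero]⟩
    exact (CechH1.subsingleton h).elim _ _
  · have hm' : (Module.finrank ℂ E : ℂ) ≠ 0 := Nat.cast_ne_zero.2 hm.ne'
    change _ = g.weylMap ((1 / (Module.finrank ℂ E : ℂ)) • c1K E M)
    have h : c1K E M = firstChernClass E (E →L[ℂ] ℂ) (HolCotangent E : M → Type _) :=
      firstChernClass_detBundle _ _
    -- Both sides are now multiples of Φ(tr b(L)): on the right, the trace of Φ contributes a factor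
    -- m, which cancels 1/m.
    rw [h, firstChernClass, normalizedAtiyahClass, g.atiyahClass_cotangent]
    simp only [map_smul, g.map_traceHom_weylMap]
    simp only [smul_smul]
    congr 1
    field_simp
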